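/- **Setting.** Fix an integer $d$ and spins $\{0,1,f\}$; let $\mathcal M=\{0,1,f\}^2$, where $\sigma=\eta\eta'\in\mathcal M$ is the pair (message from variable to clause, message from clause to variable), and let $R(\eta\eta')=\eta'\eta$. For $D$ incoming messages let $m_D$ be $1$, $f$ or $0$ according to whether the number of incoming $1$'s is $0$, $1$ or at least $2$. For $\dot\sigma\in\mathcal M^d$ let $m_d(\dot\sigma)$ be $m_d$ applied to all the incoming messages of $\dot\sigma$; let $\dot\psi(\dot\sigma)\in\{0,1\}$ indicate that every outgoing message in $\dot\sigma$ is $m_{d-1}$ of the other $d-1$ incoming ones, and let $\hat\psi(\sigma,\sigma')=\mathbf 1\{\sigma=R\sigma'\}$. For $\lambda>0$ put $\dot\psi^\lambda(\dot\sigma)=\dot\psi(\dot\sigma)\lambda^{\mathbf 1\{m_d(\dot\sigma)=1\}}$ and $\hat\psi^\lambda(\sigma,\sigma')=\hat\psi(\sigma,\sigma')\lambda^{\mathbf 1\{\sigma=11\}}$. Let $\Delta$ be the set of pairs $H=(\dot H,\hat H)$ of probability measures on $\operatorname{supp}\dot\psi$ and $\operatorname{supp}\hat\psi$ that have the same edge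 marginal $\bar H$ on $\mathcal M$, i.e. $$\bar H(\sigma)=\frac1d\sum_{\dot\sigma}\#\{i:\dot\sigma_i=\sigma\}\,\dot H(\dot\sigma)=\frac12\sum_{(\sigma^1,\sigma^2)}\#\{i:\sigma^i=\sigma\}\,\hat H(\sigma^1,\sigma^2),$$ and satisfy $\dot H(m_d=f)\le\beta_{\max}:=d^{-3/2}$. The intensity of $H$ is $\mathbf i(H)=\dot H(m_d=1)+\frac12\dot H(m_d=f)$, and $\Delta_\alpha=\{H\in\Delta:\mathbf i(H)=\alpha\}$. The rate function is (with the convention $0\log(\cdot/0)=0$) $$\Phi(H)=\sum_{\dot\sigma}\dot H(\dot\sigma)\log\frac{\dot\psi(\dot\sigma)}{\dot H(\dot\sigma)}+\frac d2\sum_{\hat\sigma}\hat H(\hat\sigma)\log\frac{\hat\psi(\hat\sigma)}{\hat H(\hat\sigma)}-d\sum_\sigma\bar H(\sigma)\log\frac1{\bar H(\sigma)},$$ and $\Phi^\lambda(H)=\Phi(H)+\mathbf i(H)\log\lambda$. A stationary point of $\Phi^\lambda$ is a pair $H$ as above (but without the constraint $\dot H(m_d=f)\le\beta_{\max}$) that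 is strictly positive on the two supports and at which the derivative of $\Phi^\lambda$ vanishes along every signed direction supported there that preserves total masses and equality of the two marginals. The *frozen model recursions* for a probability measure $q$ on $\{0,1,f\}$ are $$q_1=\frac{\lambda(1-q_1)^{d-1}}{(\lambda-1)(1-q_1)^{d-1}+1},\qquad q_f=\frac{(d-1)q_1(1-q_1)^{d-2}}{(\lambda-1)(1-q_1)^{d-1}+1}.$$ The *Bethe recursions* for a pair $h=(\dot h,\hat h)$ of probability measures on $\mathcal M$ are, with positive normalizing constants $\dot z,\hat z$, $$\dot z\,\dot h_\sigma=\sum_{\dot\sigma:\sigma_1=\sigma}\dot\psi^\lambda(\dot\sigma)\prod_{i=2}^d\hat h_{\sigma_i},\qquad \hat z\,\hat h_\sigma=\sum_{\sigma'}\hat\psi^\lambda(\sigma,\sigma')\,\dot h_{\sigma'} .$$ A solution is *symmetric* if $\dot h_{f1}=\dot h_{f0}=\dot h_{ff}$, $\hat h_{1f}=\hat h_{0f}=\hat h_{ff}$, $\lambda\dot h_{11}=\dot h_{10}=\dot h_{1f}$ and $\hat h_{11}=\hat h_{01}=\hat h_{f1}$. A pair $H$ *corresponds* to $h$ if, for some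 positive constants, $$\dot H(\dot\sigma)\propto\dot\psi^\lambda(\dot\sigma)\prod_{i=1}^d\hat h_{\sigma_i},\qquad \hat H(\sigma^1,\sigma^2)\propto\hat\psi^\lambda(\sigma^1,\sigma^2)\,\dot h_{\sigma^1}\dot h_{\sigma^2},\qquad \bar H(\sigma)\propto\hat h_\sigma\dot h_\sigma .$$ **Theorem.** There is an absolute constant $d_0$ such that the following holds for all $d\ge d_0$. 1. For every $\lambda>1$ the frozen model recursions have a unique solution $q^\lambda$; the Bethe recursions have a unique symmetric solution $h^\lambda$, and it satisfies $\hat h^\lambda_{\eta'\eta}=\frac13q^\lambda_\eta$ for all $\eta,\eta'$; and there is a unique stationary point $H^\lambda_\star$ of $\Phi^\lambda$ that corresponds to $h^\lambda$. 2. For every $\alpha$ with $\frac{(5/3)\log d}{d}\le\alpha\le\frac{2\log d}{d}$ there is exactly one $\lambda>1$ with $H^\lambda_\star\in\Delta_\alpha$, i.e. such that $H^\lambda_\star$ has intensity $\alpha$ and $\dot H^\lambda_\star(m_d=f)\le\beta_{\max}$. For this $\lambda$ the last inequality is strict, and $H^\lambda_\star$ is the unique maximizer of $\Phi$ on $\Delta_\alpha$: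 $\Phi(K)<\Phi(H^\lambda_\star)$ for every $K\in\Delta_\alpha$ with $K\ne H^\lambda_\star$. -/

import Mathlib

open scoped BigOperators

namespace FrozenModel

/-- The three spins: unoccupied, occupied, free. -/
inductive Spin where
  | zero
  | one
  | free
  deriving DecidableEq

instance : Fintype Spin where
  elems := {Spin.zero, Spin.one, Spin.free}
  complete := by intro x; cases x <;> simp

/-- Spins of the auxiliary model on an edge (variable, clause):
`(message variable → clause, message clause → variable)`. -/
abbrev Msg : Type := Spin × Spin

/-- The reflection of an edge spin. -/
def refl (s : Msg) : Msg := (s.2, s.1)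

/-- The message-passing rule, as a function of the number of incoming `one` messages. -/
def rule : ℕ → Spin
  | 0 => Spin.one
  | 1 => Spin.free
  | _ + 2 => Spin.zero

/-- The spin of a variable, computed from all of its `d` incoming messages. -/
def vertexSpin {d : ℕ} (s : Fin d → Msg) : Spin :=
  rule (Finset.univ.filter (fun i => (s i).2 = Spin.one)).card

/-- The message sent along edge `i`, computed from the other `d - 1` incoming messages. -/
def outMessage {d : ℕ} (s : Fin d → Msg) (i : Fin d) : Spin :=
  rule (Finset.univ.filter (fun j => j ≠ i ∧ (s j).2 = Spin.one)).card

/-- Variable factor: indicator that all outgoing messages obey the message-passing rule. -/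
def psiVar {d : ℕ} (s : Fin d → Msg) : ℝ :=
  if ∀ i, (s i).1 = outMessage s i then 1 else 0

/-- Clause factor: indicator that the two edge spins are reflections of each other. -/
def psiCl (s : Msg × Msg) : ℝ :=
  if s.1 = refl s.2 then 1 else 0

/-- Variable factor with fugacity `lam`. -/
noncomputable def psiVarW {d : ℕ} (lam : ℝ) (s : Fin d → Msg) : ℝ :=
  psiVar s * (if vertexSpin s = Spin.one then lam else 1)

/-- Clause factor with fugacity `lam`. -/
noncomputable def psiClW (lam : ℝ) (s : Msg × Msg) : ℝ :=
  psiCl s * (if s.1 = (Spin.one, Spin.one) then lam else 1)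

/-- Pairs (variable empirical measure, clause empirical measure), as vectors. -/
abbrev Emp (d : ℕ) : Type := ((Fin d → Msg) → ℝ) × (Msg × Msg → ℝ)

/-- Edge marginal computed from the variable empirical measure:
`d⁻¹ ∑ (number of occurrences of σ in s) H(s)`. -/
noncomputable def varMarginal {d : ℕ} (H : Emp d) (σ : Msg) : ℝ :=
  (d : ℝ)⁻¹ * ∑ s : Fin d → Msg, ((Finset.univ.filter (fun i => s i = σ)).card : ℝ) * H.1 s

/-- Edge marginal computed from the clause empirical measure. -/
noncomputable def clMarginal {d : ℕ} (H : Emp d) (σ : Msg) : ℝ :=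
  (2 : ℝ)⁻¹ * ∑ s : Msg × Msg,
    ((if s.1 = σ then 1 else 0) + (if s.2 = σ then 1 else 0)) * H.2 s

/-- The density of variables with spin `η`. -/
noncomputable def density {d : ℕ} (H : Emp d) (η : Spin) : ℝ :=
  ∑ s : Fin d → Msg, if vertexSpin s = η then H.1 s else 0

/-- The normalized intensity. -/
noncomputable def intensity {d : ℕ} (H : Emp d) : ℝ :=
  density H Spin.one + (1 / 2) * density H Spin.free

/-- `H` vanishes outside the supports of the factors. -/
def IsSupported {d : ℕ} (H : Emp d) : Prop :=
  (∀ s, psiVar s = 0 → H.1 s = 0) ∧ (∀ s, psiCl s = 0 → H.2 s = 0)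

/-- Pairs of probability measures on the supports of the factors, with the same edge marginals. -/
def IsBalanced {d : ℕ} (H : Emp d) : Prop :=
  IsSupported H ∧ (∀ s, 0 ≤ H.1 s) ∧ (∀ s, 0 ≤ H.2 s) ∧
    ∑ s, H.1 s = 1 ∧ ∑ s, H.2 s = 1 ∧ ∀ σ, varMarginal H σ = clMarginal H σ

/-- Truncation level for the density of free variables. -/
noncomputable def betaMax (d : ℕ) : ℝ := (d : ℝ) ^ (-(3 / 2) : ℝ)

/-- The truncated simplex. -/
def simplex (d : ℕ) : Set (Emp d) :=
  {H | IsBalanced H ∧ density H Spin.free ≤ betaMax d}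

/-- The part of the truncated simplex at normalized intensity `α`. -/
def simplexAt (d : ℕ) (α : ℝ) : Set (Emp d) :=
  {H | H ∈ simplex d ∧ intensity H = α}

/-- The first-moment rate function. Summands with `H = 0` vanish, as usual. -/
noncomputable def rate {d : ℕ} (H : Emp d) : ℝ :=
  (∑ s : Fin d → Msg, H.1 s * Real.log (psiVar s / H.1 s))
    + (d : ℝ) / 2 * (∑ s : Msg × Msg, H.2 s * Real.log (psiCl s / H.2 s))
    - (d : ℝ) * ∑ σ : Msg, varMarginal H σ * Real.log (1 / varMarginal H σ)

/-- The rate function with fugacity `lam`. -/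
noncomputable def rateW {d : ℕ} (lam : ℝ) (H : Emp d) : ℝ :=
  rate H + intensity H * Real.log lam

/-- Directions tangent to the space of balanced pairs. -/
def IsTangent {d : ℕ} (D : Emp d) : Prop :=
  IsSupported D ∧ ∑ s, D.1 s = 0 ∧ ∑ s, D.2 s = 0 ∧ ∀ σ, varMarginal D σ = clMarginal D σ

/-- `H` is strictly positive on the supports of the factors. -/
def IsPositive {d : ℕ} (H : Emp d) : Prop :=
  (∀ s, psiVar s ≠ 0 → 0 < H.1 s) ∧ (∀ s, psiCl s ≠ 0 → 0 < H.2 s)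

/-- Strictly positive stationary points of the rate function with fugacity `lam`: the derivative
exists and vanishes along every tangent direction (the intensity is not held fixed). -/
def IsStationary {d : ℕ} (lam : ℝ) (H : Emp d) : Prop :=
  IsBalanced H ∧ IsPositive H ∧
    ∀ D : Emp d, IsTangent D → HasDerivAt (fun t : ℝ => rateW lam (H + t • D)) 0 0

/-- Probability vectors on a finite type. -/
def IsProb {ι : Type} [Fintype ι] (p : ι → ℝ) : Prop :=
  (∀ i, 0 ≤ p i) ∧ ∑ i, p i = 1

/-- Probability measures on spins that solve the frozen model recursions. -/
def IsFrozenFixedPoint (d : ℕ) (lam : ℝ) (q : Spin → ℝ) : Prop :=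
  IsProb q ∧
    q Spin.one = lam * (1 - q Spin.one) ^ (d - 1)
      / ((lam - 1) * (1 - q Spin.one) ^ (d - 1) + 1) ∧
    q Spin.free = ((d : ℝ) - 1) * q Spin.one * (1 - q Spin.one) ^ (d - 2)
      / ((lam - 1) * (1 - q Spin.one) ^ (d - 1) + 1)

/-- Pairs (variable-to-clause law, clause-to-variable law) on edge spins. -/
abbrev Messages : Type := (Msg → ℝ) × (Msg → ℝ)

/-- Solutions of the Bethe recursions. The distinguished edge is an arbitrary `i`; as the variable
factor is symmetric, all choices give the same equation. -/
def IsBetheSolution (d : ℕ) (lam : ℝ) (h : Messages) : Prop :=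
  IsProb h.1 ∧ IsProb h.2 ∧
    (∃ z : ℝ, 0 < z ∧ ∀ (i : Fin d) (σ : Msg),
      z * h.1 σ = ∑ s ∈ Finset.univ.filter (fun s : Fin d → Msg => s i = σ),
        psiVarW lam s * ∏ j ∈ Finset.univ.erase i, h.2 (s j)) ∧
    (∃ z : ℝ, 0 < z ∧ ∀ σ : Msg,
      z * h.2 σ = ∑ τ : Msg, psiClW lam (σ, τ) * h.1 τ)

open Spin in
/-- The symmetry relations for a solution of the Bethe recursions. -/
def BetheSymmetric (lam : ℝ) (h : Messages) : Prop :=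
  (h.1 (free, one) = h.1 (free, zero) ∧ h.1 (free, zero) = h.1 (free, free)) ∧
  (h.2 (one, free) = h.2 (zero, free) ∧ h.2 (zero, free) = h.2 (free, free)) ∧
  (lam * h.1 (one, one) = h.1 (one, zero) ∧ h.1 (one, zero) = h.1 (one, free)) ∧
  (h.2 (one, one) = h.2 (zero, one) ∧ h.2 (zero, one) = h.2 (free, one))

/-- `H` is the pair of empirical measures associated with the messages `h`. -/
def Corresponds {d : ℕ} (lam : ℝ) (h : Messages) (H : Emp d) : Prop :=
  (∃ z : ℝ, 0 < z ∧ ∀ s : Fin d → Msg, z * H.1 s = psiVarW lam s * ∏ i, h.2 (s i)) ∧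
  (∃ z : ℝ, 0 < z ∧ ∀ s : Msg × Msg, z * H.2 s = psiClW lam s * (h.1 s.1 * h.1 s.2)) ∧
  (∃ z : ℝ, 0 < z ∧ ∀ σ : Msg, z * varMarginal H σ = h.2 σ * h.1 σ)

end FrozenModel

/-! The symmetric point is completely explicit. A valid configuration at a variable is determined by
its incoming messages, so sums of product weights become binomial sums over the number n of incoming
ones, with geometric terms from n = 2 on. Under the symmetry relations the Bethe recursions thereby
collapse to the frozen model recursions, whose mass at 1 is the fixed point of a decreasing
function. The logarithms of the resulting pair H are sums of log q over edges. In the derivative of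
the rate function these cancel between variable, clause and edge terms, leaving the intensity times
log λ up to a constant (`sum_log_empirical`). This yields both stationarity and the value of the
rate at H.

For maximality, let K have spin densities p₁, β, p₀. For any θ in (0,1) compare its variable measure
with an explicit one: given spin 1 or f the edges follow the edge marginal of K, and given spin 0
each edge independently has an incoming one with probability θ, conditioned on at least two. Then
−Φ(K) is `rateBound`, a function of the densities and θ alone, plus three nonnegative relative
entropies (`neg_rate_eq`, `rate_le`). At H, with θ equal to the mass q₁ of q at 1, the bound is
attained (`rate_empirical_eq_rateBound`).

At fixed intensity only one parameter remains: the change δ of the free density, which lowers p₁ and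
p₀ by δ/2 each. With θ = q₁(p₁ − δ/2)/p₁ all first-order terms cancel. The convexity of β log β on
[0, β_max] gains δ²/(8β_max), while everything else costs at most 6dδ² (`rateBound_ge`). Since β_max
= d^(−3/2), the gain wins for large d; this is where the truncation enters. If δ = 0, the equality
cases of the relative entropies force K = H (`eq_of_eq_comparison`).

A fugacity for each α comes from the intermediate value theorem in the variable q₁
(`exists_intensity`). Its uniqueness needs no monotonicity: two admissible stationary points would
each be the strict maximizer on the same set, hence equal, and H determines λ
(`eq_of_empirical_eq`). -/

namespace FrozenModel

/-! ### Sums of product weights over valid variable configurations. -/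

/-- The set of edges with an incoming `one`. -/
def ones {d : ℕ} (t : Fin d → Spin) : Finset (Fin d) :=
  Finset.univ.filter (fun i => t i = Spin.one)

/-- The valid configuration with the given incoming messages. -/
def ofIncoming {d : ℕ} (t : Fin d → Spin) : Fin d → Msg :=
  fun i => (rule ((ones t).erase i).card, t i)

theorem outMessage_eq {d : ℕ} (s : Fin d → Msg) (i : Fin d) :
    outMessage s i = rule ((ones fun j => (s j).2).erase i).card := by
  unfold outMessage ones
  congr 2
  ext j
  simp

theorem psiVar_eq {d : ℕ} (s : Fin d → Msg) :
    psiVar s = if (fun i => (s i).1) = fun i => rule ((ones fun j => (s j).2).erase i).card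
      then 1 else 0 := by
  unfold psiVar
  simp only [outMessage_eq, funext_iff]

theorem psiVar_ne_zero_iff {d : ℕ} (s : Fin d → Msg) :
    psiVar s ≠ 0 ↔ ∀ i, (s i).1 = rule ((ones fun j => (s j).2).erase i).card := by
  unfold psiVar
  simp only [outMessage_eq]
  simp

theorem psiVar_of_ne {d : ℕ} {s : Fin d → Msg} (h : psiVar s ≠ 0) : psiVar s = 1 := by
  unfold psiVar at *
  split_ifs at * with h1
  · rfl
  · exact absurd rfl h

theorem psiVar_nonneg {d : ℕ} (s : Fin d → Msg) : 0 ≤ psiVar s := by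
  unfold psiVar
  split_ifs <;> norm_num

/-- Outgoing messages are functions of the incoming ones, so each incoming vector extends to exactly
one valid configuration. -/
theorem sum_psiVar_mul {d : ℕ} (F : (Fin d → Msg) → ℝ) :
    ∑ s, psiVar s * F s = ∑ t, F (ofIncoming t) := by
  rw [← (Equiv.arrowProdEquivProdArrow (Fin d) (fun _ => Spin) (fun _ => Spin)).symm.sum_comp,
    Fintype.sum_prod_type_right]
  refine Finset.sum_congr rfl fun t _ => ?_
  rw [Finset.sum_eq_single (fun i => rule ((ones t).erase i).card)]
  · rw [psiVar_eq, if_pos (by rfl), one_mul]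
    rfl
  · intro o _ ho
    rw [psiVar_eq, if_neg, zero_mul]
    exact ho
  · simp

theorem sum_ones_eq {d : ℕ} (S : Finset (Fin d)) (f : Fin d → Spin → ℝ) :
    ∑ t ∈ Finset.univ.filter (fun t : Fin d → Spin => ones t = S), ∏ j, f j (t j)
      = ∏ j, if j ∈ S then f j Spin.one else f j Spin.zero + f j Spin.free := by
  have : Finset.univ.filter (fun t : Fin d → Spin => ones t = S)
      = Fintype.piFinset fun j => if j ∈ S then {Spin.one} else {Spin.zero, Spin.free} := by
    ext t
    simp only [Finset.mem_filter, Finset.mem_univ, true_and, Fintype.mem_piFinset]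
    constructor
    · rintro rfl j
      by_cases h : t j = Spin.one
      · simp [ones, h]
      · cases ht : t j <;> simp_all [ones]
    · intro h
      ext j
      have := h j
      by_cases hj : j ∈ S
      · simp_all [ones]
      · simp only [hj, if_false] at this
        simp only [ones, Finset.mem_filter, Finset.mem_univ, true_and, hj, iff_false]
        intro h1
        simp [h1] at this
  rw [this, ← Finset.prod_univ_sum]
  refine Finset.prod_congr rfl fun j _ => ?_
  split_ifs <;> simp

/-- Outgoing messages depend on the incoming vector only through its set of ones; on each fiber of
that set the remaining entries range freely over 0 and f, so the sum factorizes. The edge weight may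
depend on the set because the outgoing message does. -/
theorem sum_incoming_mul {d : ℕ} (G : ℕ → ℝ) (f : Finset (Fin d) → Fin d → Spin → ℝ) :
    ∑ t : Fin d → Spin, G (ones t).card * ∏ j, f (ones t) j (t j)
      = ∑ S : Finset (Fin d), G S.card * ∏ j,
          if j ∈ S then f S j Spin.one else f S j Spin.zero + f S j Spin.free := by
  rw [← Finset.sum_fiberwise (s := Finset.univ) (g := ones)]
  refine Finset.sum_congr rfl fun S _ => ?_
  rw [← sum_ones_eq, Finset.mul_sum]
  refine Finset.sum_congr rfl fun t ht => ?_
  simp only [Finset.mem_filter, Finset.mem_univ, true_and] at ht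
  rw [ht]

/-- Total mass of a weight of product form over valid configurations. -/
theorem sum_psiVar_prod {d : ℕ} (τ : Spin → ℝ) (φ : Msg → ℝ) :
    ∑ s : Fin d → Msg, psiVar s * (τ (vertexSpin s) * ∏ j, φ (s j))
      = ∑ n ∈ Finset.range (d + 1), (d.choose n : ℝ) * (τ (rule n) *
          (φ (rule (n - 1), Spin.one) ^ n *
            (φ (rule n, Spin.zero) + φ (rule n, Spin.free)) ^ (d - n))) := by
  rw [sum_psiVar_mul]
  have h := sum_incoming_mul (d := d) (fun n => τ (rule n))
    (fun S j η => φ (rule (S.erase j).card, η))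
  refine h.trans ?_
  have h2 := Finset.sum_powerset_apply_card (x := (Finset.univ : Finset (Fin d)))
    (fun n => τ (rule n) * (φ (rule (n - 1), Spin.one) ^ n *
      (φ (rule n, Spin.zero) + φ (rule n, Spin.free)) ^ (d - n)))
  simp only [Finset.powerset_univ, Finset.card_univ, Fintype.card_fin, nsmul_eq_mul] at h2
  rw [← h2]
  refine Finset.sum_congr rfl fun S _ => ?_
  congr 1
  rw [Finset.prod_ite, Finset.prod_congr rfl (g := fun _ => φ (rule (S.card - 1), Spin.one)),
    Finset.prod_congr (s₁ := Finset.filter (fun j => j ∉ S) Finset.univ) rfl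
      (g := fun _ => φ (rule S.card, Spin.zero) + φ (rule S.card, Spin.free))]
  · rw [Finset.prod_const, Finset.prod_const]
    have e1 : Finset.filter (fun j => j ∈ S) Finset.univ = S := by ext; simp
    have e2 : Finset.filter (fun j => j ∉ S) Finset.univ = Sᶜ := by ext; simp
    rw [e1, e2, Finset.card_compl, Fintype.card_fin]
  · intro j hj
    simp only [Finset.mem_filter, Finset.mem_univ, true_and] at hj
    rw [Finset.erase_eq_of_notMem hj]
  · intro j hj
    simp only [Finset.mem_filter, Finset.mem_univ, true_and] at hj
    rw [Finset.card_erase_of_mem hj]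

/-- Binomial sums whose terms are geometric from index two on. -/
theorem sum_choose_tail {N : ℕ} (hN : 1 ≤ N) (F : ℕ → ℝ) (c u v : ℝ)
    (hF : ∀ n, 2 ≤ n → F n = c * (u ^ n * v ^ (N - n))) :
    ∑ n ∈ Finset.range (N + 1), (N.choose n : ℝ) * F n
      = F 0 + N * F 1 + c * ((u + v) ^ N - v ^ N - N * u * v ^ (N - 1)) := by
  obtain ⟨M, rfl⟩ : ∃ M, N = M + 1 := ⟨N - 1, by omega⟩
  rw [add_pow, Finset.sum_range_succ', Finset.sum_range_succ', Finset.sum_range_succ',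
    Finset.sum_range_succ']
  have : ∑ k ∈ Finset.range M, ((M + 1).choose (k + 1 + 1) : ℝ) * F (k + 1 + 1)
      = c * ∑ k ∈ Finset.range M, u ^ (k + 1 + 1) * v ^ (M + 1 - (k + 1 + 1))
          * ((M + 1).choose (k + 1 + 1) : ℝ) := by
    rw [Finset.mul_sum]
    refine Finset.sum_congr rfl fun k _ => ?_
    rw [hF _ (by omega)]
    ring
  rw [this]
  simp
  ring

theorem rule_of_two_le {n : ℕ} (h : 2 ≤ n) : rule n = Spin.zero := by
  obtain ⟨m, rfl⟩ : ∃ m, n = m + 2 := ⟨n - 2, by omega⟩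
  rfl

/-- An edge carrying one of n incoming ones sends `rule (n - 1)`, which is f for n = 2 but 0 for n ≥
3. The hypothesis `hφ` erases this difference, so the terms are geometric already from n = 2. -/
theorem sum_psiVar_prod_eq {d : ℕ} (hd : 1 ≤ d) (τ : Spin → ℝ) (φ : Msg → ℝ)
    (hφ : φ (Spin.free, Spin.one) = φ (Spin.zero, Spin.one)) :
    ∑ s : Fin d → Msg, psiVar s * (τ (vertexSpin s) * ∏ j, φ (s j))
      = τ Spin.one * (φ (Spin.one, Spin.zero) + φ (Spin.one, Spin.free)) ^ d
        + d * (τ Spin.free * (φ (Spin.one, Spin.one) *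
            (φ (Spin.free, Spin.zero) + φ (Spin.free, Spin.free)) ^ (d - 1)))
        + τ Spin.zero * ((φ (Spin.zero, Spin.one) +
            (φ (Spin.zero, Spin.zero) + φ (Spin.zero, Spin.free))) ^ d
            - (φ (Spin.zero, Spin.zero) + φ (Spin.zero, Spin.free)) ^ d
            - d * φ (Spin.zero, Spin.one)
              * (φ (Spin.zero, Spin.zero) + φ (Spin.zero, Spin.free)) ^ (d - 1)) := by
  rw [sum_psiVar_prod, sum_choose_tail hd _ (τ Spin.zero) (φ (Spin.zero, Spin.one))
    (φ (Spin.zero, Spin.zero) + φ (Spin.zero, Spin.free))]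
  · simp [rule]
  · intro n hn
    rw [rule_of_two_le hn]
    rcases Nat.lt_or_ge n 3 with h | h
    · obtain rfl : n = 2 := by omega
      simp [rule, hφ]
    · rw [rule_of_two_le (by omega : 2 ≤ n - 1)]

/-- Weight of the configurations pinned to `σ` at the edge `i`. -/
noncomputable def pinned {d : ℕ} (τ : Spin → ℝ) (w : Msg → ℝ) (i : Fin d) (σ : Msg) : ℝ :=
  ∑ s ∈ Finset.univ.filter (fun s : Fin d → Msg => s i = σ),
    psiVar s * (τ (vertexSpin s) * ∏ j ∈ Finset.univ.erase i, w (s j))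

theorem pinned_eq_sum {d : ℕ} (τ : Spin → ℝ) (w : Msg → ℝ) (i : Fin d) (σ : Msg) :
    pinned τ w i σ = ∑ S ∈ (Finset.univ.erase i).powerset,
      ((if (rule S.card, σ.2) = σ ∧ σ.2 ≠ Spin.one then τ (rule S.card) *
        (w (rule (S.card - 1), Spin.one) ^ S.card *
          (w (rule S.card, Spin.zero) + w (rule S.card, Spin.free)) ^ (d - 1 - S.card)) else 0)
      + (if (rule S.card, σ.2) = σ ∧ σ.2 = Spin.one then τ (rule (S.card + 1)) *
        (w (rule S.card, Spin.one) ^ S.card *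
          (w (rule (S.card + 1), Spin.zero) + w (rule (S.card + 1), Spin.free))
            ^ (d - 1 - S.card)) else 0)) := by
  -- Pinning is itself a product weight: the factor at edge i is the indicator of σ.
  have h0 : pinned τ w i σ = ∑ s : Fin d → Msg, psiVar s * (τ (vertexSpin s) *
      ∏ j, (if j = i then (if s j = σ then 1 else 0) else w (s j))) := by
    rw [pinned, Finset.sum_filter]
    refine Finset.sum_congr rfl fun s _ => ?_
    rw [← Finset.mul_prod_erase Finset.univ _ (Finset.mem_univ i)]
    have hp : ∏ j ∈ Finset.univ.erase i, (if j = i then (if s j = σ then (1 : ℝ) else 0)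
        else w (s j)) = ∏ j ∈ Finset.univ.erase i, w (s j) :=
      Finset.prod_congr rfl fun j hj => if_neg (Finset.ne_of_mem_erase hj)
    rw [if_pos rfl, hp]
    split_ifs <;> simp
  rw [h0, sum_psiVar_mul]
  refine (sum_incoming_mul (d := d) (fun n => τ (rule n))
    (fun S j η => if j = i then (if (rule (S.erase j).card, η) = σ then 1 else 0)
      else w (rule (S.erase j).card, η))).trans ?_
  have hU : (Finset.univ : Finset (Finset (Fin d)))
      = (insert i (Finset.univ.erase i)).powerset := by
    rw [Finset.insert_erase (Finset.mem_univ i), Finset.powerset_univ]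
  -- Split by whether i itself receives a one; S then records the ones on the other edges, so the
  -- total count is |S| or |S| + 1.
  rw [hU, Finset.sum_powerset_insert (Finset.notMem_erase _ _), ← Finset.sum_add_distrib]
  refine Finset.sum_congr rfl fun S hS => ?_
  have hiS : i ∉ S := fun h => by simpa using Finset.mem_powerset.mp hS h
  have hc : ((Finset.univ.erase i).filter fun j => j ∉ S).card = d - 1 - S.card := by
    have : (Finset.univ.erase i).filter (fun j => j ∉ S) = (Finset.univ.erase i) \ S := by
      ext; simp
    rw [this, Finset.card_sdiff_of_subset (Finset.mem_powerset.mp hS),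
      Finset.card_erase_of_mem (Finset.mem_univ _), Finset.card_univ, Fintype.card_fin]
  have hc1 : (Finset.univ.erase i).filter (fun j => j ∈ S) = S := by
    ext j
    simp only [Finset.mem_filter, Finset.mem_erase, Finset.mem_univ, and_true]
    exact ⟨fun h => h.2, fun h => ⟨fun e => hiS (e ▸ h), h⟩⟩
  congr 1
  · rw [← Finset.mul_prod_erase Finset.univ _ (Finset.mem_univ i), if_neg hiS, if_pos rfl, if_pos rfl,
      Finset.erase_eq_of_notMem hiS,
      Finset.prod_congr (s₁ := Finset.univ.erase i) rfl (g := fun j => if j ∈ S then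
        w (rule (S.card - 1), Spin.one) else
          w (rule S.card, Spin.zero) + w (rule S.card, Spin.free)),
      Finset.prod_ite, Finset.prod_const, Finset.prod_const, hc, hc1]
    · obtain ⟨σ1, σ2⟩ := σ
      cases σ2 <;> simp
    · intro j hj
      have hj' := Finset.ne_of_mem_erase hj
      simp only [if_neg hj']
      by_cases hjS : j ∈ S
      · rw [if_pos hjS, if_pos hjS, Finset.card_erase_of_mem hjS]
      · rw [if_neg hjS, if_neg hjS, Finset.erase_eq_of_notMem hjS]
  · rw [← Finset.mul_prod_erase Finset.univ _ (Finset.mem_univ i),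
      if_pos (Finset.mem_insert_self _ _), if_pos rfl,
      Finset.erase_insert hiS, Finset.card_insert_of_notMem hiS,
      Finset.prod_congr (s₁ := Finset.univ.erase i) rfl (g := fun j => if j ∈ S then
        w (rule S.card, Spin.one) else
          w (rule (S.card + 1), Spin.zero) + w (rule (S.card + 1), Spin.free)),
      Finset.prod_ite, Finset.prod_const, Finset.prod_const, hc, hc1]
    · obtain ⟨σ1, σ2⟩ := σ
      cases σ2 <;> simp
    · intro j hj
      have hj' := Finset.ne_of_mem_erase hj
      simp only [if_neg hj']
      by_cases hjS : j ∈ S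
      · rw [if_pos (Finset.mem_insert_of_mem hjS), if_pos hjS,
          Finset.card_erase_of_mem (Finset.mem_insert_of_mem hjS),
          Finset.card_insert_of_notMem hiS]
        rfl
      · have : j ∉ insert i S := by simp [hj', hjS]
        rw [if_neg this, if_neg hjS, Finset.erase_eq_of_notMem this,
          Finset.card_insert_of_notMem hiS]

open Spin in
theorem pinned_eq_range {d : ℕ} (τ : Spin → ℝ) (w : Msg → ℝ) (i : Fin d) (σ : Msg) :
    pinned τ w i σ = ∑ n ∈ Finset.range (d - 1 + 1), ((d - 1).choose n : ℝ) *
      ((if (rule n, σ.2) = σ ∧ σ.2 ≠ one then τ (rule n) *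
        (w (rule (n - 1), one) ^ n *
          (w (rule n, zero) + w (rule n, free)) ^ (d - 1 - n)) else 0)
      + (if (rule n, σ.2) = σ ∧ σ.2 = one then τ (rule (n + 1)) *
        (w (rule n, one) ^ n *
          (w (rule (n + 1), zero) + w (rule (n + 1), free)) ^ (d - 1 - n)) else 0)) := by
  rw [pinned_eq_sum]
  have h2 := Finset.sum_powerset_apply_card (x := (Finset.univ : Finset (Fin d)).erase i)
    (fun n => (if (rule n, σ.2) = σ ∧ σ.2 ≠ one then τ (rule n) *
        (w (rule (n - 1), one) ^ n *
          (w (rule n, zero) + w (rule n, free)) ^ (d - 1 - n)) else 0)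
      + (if (rule n, σ.2) = σ ∧ σ.2 = one then τ (rule (n + 1)) *
        (w (rule n, one) ^ n *
          (w (rule (n + 1), zero) + w (rule (n + 1), free)) ^ (d - 1 - n)) else 0))
  simp only [Finset.card_erase_of_mem (Finset.mem_univ i), Finset.card_univ, Fintype.card_fin,
    nsmul_eq_mul] at h2
  exact h2

section pinned

open Spin

theorem pinned_one_of_ne {d : ℕ} (hd : 2 ≤ d) (τ : Spin → ℝ) (w : Msg → ℝ) (i : Fin d)
    {η : Spin} (hη : η ≠ one) :
    pinned τ w i (one, η) = τ one * (w (one, zero) + w (one, free)) ^ (d - 1) := by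
  -- Two or more ones on the other edges force the outgoing message 0, so the tail vanishes and
  -- counts as geometric with coefficient 0.
  rw [pinned_eq_range, sum_choose_tail (by omega) _ 0 0 0]
  · simp [rule, hη]
  · intro n hn
    simp [rule_of_two_le hn]

theorem pinned_one_one {d : ℕ} (hd : 2 ≤ d) (τ : Spin → ℝ) (w : Msg → ℝ) (i : Fin d) :
    pinned τ w i (one, one) = τ free * (w (free, zero) + w (free, free)) ^ (d - 1) := by
  rw [pinned_eq_range, sum_choose_tail (by omega) _ 0 0 0]
  · simp [rule]
  · intro n hn
    simp [rule_of_two_le hn]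

theorem pinned_free_of_ne {d : ℕ} (hd : 2 ≤ d) (τ : Spin → ℝ) (w : Msg → ℝ) (i : Fin d)
    {η : Spin} (hη : η ≠ one) :
    pinned τ w i (free, η) = (d - 1 : ℕ) *
      (τ free * (w (one, one) * (w (free, zero) + w (free, free)) ^ (d - 1 - 1))) := by
  rw [pinned_eq_range, sum_choose_tail (by omega) _ 0 0 0]
  · simp [rule, hη]
  · intro n hn
    simp [rule_of_two_le hn]

theorem pinned_free_one {d : ℕ} (hd : 2 ≤ d) (τ : Spin → ℝ) (w : Msg → ℝ) (i : Fin d) :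
    pinned τ w i (free, one) = (d - 1 : ℕ) *
      (τ zero * (w (free, one) * (w (zero, zero) + w (zero, free)) ^ (d - 1 - 1))) := by
  rw [pinned_eq_range, sum_choose_tail (by omega) _ 0 0 0]
  · simp [rule]
  · intro n hn
    simp [rule_of_two_le hn]

theorem pinned_zero {d : ℕ} (hd : 2 ≤ d) (τ : Spin → ℝ) (w : Msg → ℝ) (i : Fin d)
    (hw : w (free, one) = w (zero, one)) (η : Spin) :
    pinned τ w i (zero, η) = τ zero *
      ((w (zero, one) + (w (zero, zero) + w (zero, free))) ^ (d - 1)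
        - (w (zero, zero) + w (zero, free)) ^ (d - 1)
        - (d - 1 : ℕ) * w (zero, one) * (w (zero, zero) + w (zero, free)) ^ (d - 1 - 1)) := by
  rw [pinned_eq_range, sum_choose_tail (by omega) _ (τ zero) (w (zero, one))
    (w (zero, zero) + w (zero, free))]
  · simp [rule]
  · intro n hn
    by_cases hη : η = one
    · simp [rule_of_two_le hn, rule_of_two_le (by omega : 2 ≤ n + 1), hη]
    · rcases Nat.lt_or_ge n 3 with h | h
      · obtain rfl : n = 2 := by omega
        simp [rule, hη, hw]
      · simp [rule_of_two_le hn, rule_of_two_le (by omega : 2 ≤ n - 1), hη]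

end pinned

end FrozenModel

/-! ### The frozen model recursions: existence, uniqueness, positivity. -/

namespace FrozenModel

/-- With M = N − 1, Bernoulli's inequality 1 + Mt ≤ (1 + t)^M bounds the left side by (1 − t²)^M. -/
theorem binomial_le_one_lt {N : ℕ} (hN : 2 ≤ N) {t : ℝ} (h0 : 0 < t) (h1 : t < 1) :
    (1 - t) ^ N + N * t * (1 - t) ^ (N - 1) < 1 := by
  obtain ⟨M, rfl⟩ : ∃ M, N = M + 1 := ⟨N - 1, by omega⟩
  have hb := one_add_mul_le_pow (show (-2 : ℝ) ≤ t by linarith) M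
  have hx : 0 < (1 - t) ^ M := pow_pos (by linarith) M
  have hlt : ((1 - t) * (1 + t)) ^ M < 1 :=
    pow_lt_one₀ (by nlinarith) (by nlinarith) (by omega)
  rw [mul_pow] at hlt
  have := mul_le_mul_of_nonneg_left hb hx.le
  simp only [Nat.add_sub_cancel]
  push_cast
  calc (1 - t) ^ (M + 1) + (M + 1) * t * (1 - t) ^ M = (1 - t) ^ M * (1 + M * t) := by ring
    _ ≤ _ := this
    _ < 1 := hlt

theorem spin_sum (f : Spin → ℝ) : ∑ η, f η = f Spin.zero + f Spin.one + f Spin.free := by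
  have : (Finset.univ : Finset Spin) = {Spin.zero, Spin.one, Spin.free} := rfl
  rw [this, Finset.sum_insert (by decide), Finset.sum_insert (by decide), Finset.sum_singleton]
  ring

theorem msg_sum (f : Msg → ℝ) : ∑ σ, f σ =
    f (Spin.zero, Spin.zero) + f (Spin.zero, Spin.one) + f (Spin.zero, Spin.free)
    + (f (Spin.one, Spin.zero) + f (Spin.one, Spin.one) + f (Spin.one, Spin.free))
    + (f (Spin.free, Spin.zero) + f (Spin.free, Spin.one) + f (Spin.free, Spin.free)) := by
  rw [Fintype.sum_prod_type, spin_sum, spin_sum, spin_sum, spin_sum]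

open Spin

/-- The denominator in the frozen model recursions. -/
noncomputable def frozenDen (d : ℕ) (lam r : ℝ) : ℝ := (lam - 1) * (1 - r) ^ (d - 1) + 1

section frozen

variable {d : ℕ} {lam : ℝ} {q : Spin → ℝ}

theorem frozenDen_pos (hlam : 1 < lam) {r : ℝ} (hr : r ≤ 1) : 0 < frozenDen d lam r := by
  have : 0 ≤ (1 - r) ^ (d - 1) := pow_nonneg (by linarith) _
  unfold frozenDen
  nlinarith

theorem exists_frozenOne (hd : 3 ≤ d) (hlam : 1 < lam) :
    ∃ r : ℝ, 0 < r ∧ r < 1 ∧ r = lam * (1 - r) ^ (d - 1) / frozenDen d lam r := by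
  have hc : ContinuousOn (fun r : ℝ => r * frozenDen d lam r - lam * (1 - r) ^ (d - 1))
      (Set.Icc 0 1) := by
    unfold frozenDen
    fun_prop
  have h := intermediate_value_Ioo (zero_le_one) hc
  have h0 : (0 : ℝ) ∈ Set.Ioo
      ((fun r : ℝ => r * frozenDen d lam r - lam * (1 - r) ^ (d - 1)) 0)
      ((fun r : ℝ => r * frozenDen d lam r - lam * (1 - r) ^ (d - 1)) 1) := by
    have : d - 1 ≠ 0 := by omega
    simp [frozenDen, this]
    linarith
  obtain ⟨r, ⟨hr0, hr1⟩, hr⟩ := h h0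
  refine ⟨r, hr0, hr1, ?_⟩
  rw [eq_div_iff (frozenDen_pos hlam hr1.le).ne']
  linarith

/-- The equation reads r = (1 − r)^(d−1) (λ − (λ − 1) r), and both factors on the right decrease in
r on (−∞, 1] while remaining nonnegative. Exchanging r and s gives uniqueness. -/
theorem frozenOne_unique (hlam : 1 < lam) {r s : ℝ} (hs1 : s ≤ 1)
    (hr : r = lam * (1 - r) ^ (d - 1) / frozenDen d lam r)
    (hs : s = lam * (1 - s) ^ (d - 1) / frozenDen d lam s) : s ≤ r := by
  by_contra! hlt
  rw [eq_div_iff (frozenDen_pos hlam (hlt.le.trans hs1)).ne'] at hr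
  rw [eq_div_iff (frozenDen_pos hlam hs1).ne'] at hs
  unfold frozenDen at hr hs
  have hp : (1 - s) ^ (d - 1) ≤ (1 - r) ^ (d - 1) :=
    pow_le_pow_left₀ (by linarith) (by linarith) _
  have hp0 : 0 ≤ (1 - s) ^ (d - 1) := pow_nonneg (by linarith) _
  have h1 : r = (1 - r) ^ (d - 1) * (lam - (lam - 1) * r) := by linarith
  have h2 : s = (1 - s) ^ (d - 1) * (lam - (lam - 1) * s) := by linarith
  have h3 : (1 - s) ^ (d - 1) * (lam - (lam - 1) * s)
      ≤ (1 - r) ^ (d - 1) * (lam - (lam - 1) * r) := by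
    apply mul_le_mul hp _ _ (hp0.trans hp)
    · nlinarith
    · nlinarith
  linarith

theorem IsFrozenFixedPoint.one_nonneg (h : IsFrozenFixedPoint d lam q) : 0 ≤ q one := h.1.1 one

theorem IsFrozenFixedPoint.sum_eq (h : IsFrozenFixedPoint d lam q) :
    q zero + q one + q free = 1 := by
  have := h.1.2
  rwa [spin_sum] at this

theorem IsFrozenFixedPoint.one_le (h : IsFrozenFixedPoint d lam q) : q one ≤ 1 := by
  have := h.sum_eq
  have := h.1.1 zero
  have := h.1.1 free
  linarith

theorem IsFrozenFixedPoint.one_mul_den (h : IsFrozenFixedPoint d lam q) (hlam : 1 < lam) :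
    q one * frozenDen d lam (q one) = lam * (1 - q one) ^ (d - 1) := by
  rw [← eq_div_iff (frozenDen_pos hlam h.one_le).ne']
  exact h.2.1

theorem IsFrozenFixedPoint.free_mul_den (h : IsFrozenFixedPoint d lam q) (hlam : 1 < lam) :
    q free * frozenDen d lam (q one) = ((d : ℝ) - 1) * q one * (1 - q one) ^ (d - 2) := by
  rw [← eq_div_iff (frozenDen_pos hlam h.one_le).ne']
  exact h.2.2

theorem IsFrozenFixedPoint.zero_mul_den (h : IsFrozenFixedPoint d lam q) (hlam : 1 < lam) :
    q zero * frozenDen d lam (q one)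
      = 1 - (1 - q one) ^ (d - 1) - ((d : ℝ) - 1) * q one * (1 - q one) ^ (d - 2) := by
  have h1 := h.one_mul_den hlam
  have h2 := h.free_mul_den hlam
  have h3 := h.sum_eq
  have h4 : q zero * frozenDen d lam (q one) = frozenDen d lam (q one)
      - q one * frozenDen d lam (q one) - q free * frozenDen d lam (q one) := by
    linear_combination frozenDen d lam (q one) * h3
  rw [h4, h1, h2]
  unfold frozenDen
  ring

theorem IsFrozenFixedPoint.one_lt (h : IsFrozenFixedPoint d lam q) (hd : 3 ≤ d) (hlam : 1 < lam) :
    q one < 1 := by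
  refine lt_of_le_of_ne h.one_le fun h1 => ?_
  have := h.one_mul_den hlam
  have hd' : d - 1 ≠ 0 := by omega
  rw [h1] at this
  simp [frozenDen, hd'] at this

theorem IsFrozenFixedPoint.one_pos (h : IsFrozenFixedPoint d lam q) (hlam : 1 < lam) :
    0 < q one := by
  refine lt_of_le_of_ne h.one_nonneg fun h1 => ?_
  have := h.one_mul_den hlam
  rw [← h1] at this
  simp at this
  linarith

theorem IsFrozenFixedPoint.free_pos (h : IsFrozenFixedPoint d lam q) (hd : 3 ≤ d)
    (hlam : 1 < lam) : 0 < q free := by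
  have h1 := h.free_mul_den hlam
  have hd' : (3 : ℝ) ≤ d := by exact_mod_cast hd
  have h2 : 0 < ((d : ℝ) - 1) * q one * (1 - q one) ^ (d - 2) :=
    mul_pos (mul_pos (by linarith) (h.one_pos hlam))
      (pow_pos (by linarith [h.one_lt hd hlam]) _)
  rw [← h1] at h2
  exact pos_of_mul_pos_left h2 (frozenDen_pos hlam h.one_le).le

theorem IsFrozenFixedPoint.zero_pos (h : IsFrozenFixedPoint d lam q) (hd : 3 ≤ d)
    (hlam : 1 < lam) : 0 < q zero := by
  have h1 := h.zero_mul_den hlam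
  have h2 := binomial_le_one_lt (N := d - 1) (by omega) (h.one_pos hlam) (h.one_lt hd hlam)
  rw [Nat.cast_pred (by omega : 0 < d), show d - 1 - 1 = d - 2 by omega] at h2
  have h3 : 0 < q zero * frozenDen d lam (q one) := by linarith
  exact pos_of_mul_pos_left h3 (frozenDen_pos hlam h.one_le).le

theorem IsFrozenFixedPoint.pos (h : IsFrozenFixedPoint d lam q) (hd : 3 ≤ d)
    (hlam : 1 < lam) (η : Spin) : 0 < q η := by
  cases η
  · exact h.zero_pos hd hlam
  · exact h.one_pos hlam
  · exact h.free_pos hd hlam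

/-- The solution of the frozen model recursions built from its mass at `one`. -/
noncomputable def frozenLaw (d : ℕ) (lam r : ℝ) : Spin → ℝ
  | one => r
  | free => ((d : ℝ) - 1) * r * (1 - r) ^ (d - 2) / frozenDen d lam r
  | zero => 1 - r - ((d : ℝ) - 1) * r * (1 - r) ^ (d - 2) / frozenDen d lam r

theorem isFrozenFixedPoint_frozenLaw (hd : 3 ≤ d) (hlam : 1 < lam) {r : ℝ} (h0 : 0 < r)
    (h1 : r < 1) (hr : r = lam * (1 - r) ^ (d - 1) / frozenDen d lam r) :
    IsFrozenFixedPoint d lam (frozenLaw d lam r) := by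
  have hD := frozenDen_pos (d := d) hlam h1.le
  have hd' : (3 : ℝ) ≤ d := by exact_mod_cast hd
  refine ⟨⟨?_, ?_⟩, hr, rfl⟩
  · intro η
    cases η
    · have h2 := binomial_le_one_lt (N := d - 1) (by omega) h0 h1
      rw [Nat.cast_pred (by omega : 0 < d), show d - 1 - 1 = d - 2 by omega] at h2
      have h3 : frozenLaw d lam r zero = (1 - (1 - r) ^ (d - 1)
          - ((d : ℝ) - 1) * r * (1 - r) ^ (d - 2)) / frozenDen d lam r := by
        rw [eq_div_iff hD.ne']
        rw [eq_div_iff hD.ne'] at hr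
        simp only [frozenLaw]
        rw [sub_mul, sub_mul, div_mul_cancel₀ _ hD.ne', hr]
        unfold frozenDen
        ring
      rw [h3]
      exact div_nonneg (by linarith) hD.le
    · exact h0.le
    · exact div_nonneg (mul_nonneg (mul_nonneg (by linarith) h0.le)
        (pow_nonneg (by linarith) _)) hD.le
  · rw [spin_sum]
    simp only [frozenLaw]
    ring

theorem IsFrozenFixedPoint.eq (h : IsFrozenFixedPoint d lam q) {p : Spin → ℝ} (hlam : 1 < lam)
    (hp : IsFrozenFixedPoint d lam p) : p = q := by
  have h1 : p one = q one :=
    le_antisymm (frozenOne_unique hlam hp.one_le h.2.1 hp.2.1)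
      (frozenOne_unique hlam h.one_le hp.2.1 h.2.1)
  have h2 : p free = q free := by rw [h.2.2, hp.2.2, h1]
  have h3 := h.sum_eq
  have h4 := hp.sum_eq
  funext η
  cases η
  · linarith
  · exact h1
  · exact h2

theorem exists_isFrozenFixedPoint (hd : 3 ≤ d) (hlam : 1 < lam) :
    ∃ q, IsFrozenFixedPoint d lam q := by
  obtain ⟨r, h0, h1, hr⟩ := exists_frozenOne hd hlam
  exact ⟨_, isFrozenFixedPoint_frozenLaw hd hlam h0 h1 hr⟩

end frozen

/-! ### Symmetric solutions of the Bethe recursions. -/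

/-- The fugacity as a function of the vertex spin. -/
def fugacity (lam : ℝ) (η : Spin) : ℝ := if η = one then lam else 1

/-- The symmetric message laws built from a law on spins. -/
noncomputable def messages (lam : ℝ) (q : Spin → ℝ) : Messages :=
  (fun σ => (if σ = (one, one) then q one / lam else q σ.1) / (3 - q one + q one / lam),
    fun σ => q σ.2 / 3)

theorem sum_psiClW_mul (lam : ℝ) (f : Msg → ℝ) (σ : Msg) :
    ∑ τ, psiClW lam (σ, τ) * f τ = (if σ = (one, one) then lam else 1) * f (refl σ) := by
  rw [Finset.sum_eq_single (refl σ)]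
  · simp [psiClW, psiCl, refl]
  · intro τ _ hτ
    have : σ ≠ refl τ := fun h => hτ (by rw [h]; rfl)
    simp [psiClW, psiCl, this]
  · simp

theorem betheSum_eq {d : ℕ} (lam : ℝ) (w : Msg → ℝ) (i : Fin d) (σ : Msg) :
    ∑ s ∈ Finset.univ.filter (fun s : Fin d → Msg => s i = σ),
        psiVarW lam s * ∏ j ∈ Finset.univ.erase i, w (s j) = pinned (fugacity lam) w i σ := by
  unfold pinned
  refine Finset.sum_congr rfl fun s _ => ?_
  rw [psiVarW, mul_assoc]
  rfl

theorem isBethe_messages {d : ℕ} {lam : ℝ} {q : Spin → ℝ} (hd : 3 ≤ d) (hlam : 1 < lam)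
    (hq : IsFrozenFixedPoint d lam q) :
    IsBetheSolution d lam (messages lam q) ∧ BetheSymmetric lam (messages lam q) := by
  have hlam0 : lam ≠ 0 := by linarith
  have hpos := hq.pos hd hlam
  have hsum := hq.sum_eq
  have hlt := hq.one_lt hd hlam
  have hN : 0 < 3 - q one + q one / lam := by
    have : 0 < q one / lam := div_pos (hpos one) (by linarith)
    linarith
  have hD := frozenDen_pos (d := d) hlam hq.one_le
  have hx : q zero + q free = 1 - q one := by linarith
  have e1 := hq.one_mul_den hlam
  have e2 := hq.free_mul_den hlam
  have e3 := hq.zero_mul_den hlam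
  have hpred : ((d - 1 : ℕ) : ℝ) = d - 1 := Nat.cast_pred (by omega)
  have hd2 : d - 1 - 1 = d - 2 := by omega
  have hV : ∀ η, (messages lam q).2 (η, zero) + (messages lam q).2 (η, free)
      = (1 - q one) / 3 := by
    intro η
    simp only [messages]
    rw [← hx]
    ring
  have h31 : (3 : ℝ) ^ (d - 1) = 3 * 3 ^ (d - 2) := by
    rw [← hd2, ← pow_succ']
    congr 1
    omega
  refine ⟨⟨⟨?_, ?_⟩, ⟨?_, ?_⟩, ⟨frozenDen d lam (q one) * (3 - q one + q one / lam)
    / 3 ^ (d - 1), by positivity, ?_⟩, ⟨3 / (3 - q one + q one / lam), by positivity, ?_⟩⟩, ?_⟩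
  · intro σ
    simp only [messages]
    refine div_nonneg ?_ hN.le
    split_ifs
    · exact div_nonneg (hpos one).le (by linarith)
    · exact (hpos _).le
  · rw [msg_sum]
    simp only [messages, Prod.mk.injEq, reduceCtorEq, and_self, and_true, and_false, if_false,
      if_true]
    simp only [← add_div]
    rw [div_eq_one_iff_eq hN.ne']
    linarith
  · intro σ
    exact div_nonneg (hpos _).le (by norm_num)
  · rw [msg_sum]
    simp only [messages]
    linarith
  · intro i σ
    rw [betheSum_eq]
    have hz : ∀ c : ℝ, frozenDen d lam (q one) * (3 - q one + q one / lam) / 3 ^ (d - 1)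
        * (c / (3 - q one + q one / lam)) = c * frozenDen d lam (q one) / 3 ^ (d - 1) := by
      intro c
      have : ∀ N : ℝ, N ≠ 0 → frozenDen d lam (q one) * N / 3 ^ (d - 1) * (c / N)
          = c * frozenDen d lam (q one) / 3 ^ (d - 1) := by
        intro N hN
        field_simp
      exact this _ hN.ne'
    obtain ⟨σ1, σ2⟩ := σ
    cases σ1
    · rw [pinned_zero (by omega) _ _ _ rfl, hV, hpred, hd2]
      simp only [messages, Prod.mk.injEq, reduceCtorEq, false_and, if_false, fugacity]
      rw [hz, e3, h31]
      have : q one / 3 + (1 - q one) / 3 = 1 / 3 := by ring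
      rw [this, div_pow, div_pow, div_pow, h31, one_pow]
      field_simp
    · by_cases h2 : σ2 = one
      · subst h2
        rw [pinned_one_one (by omega), hV]
        simp only [messages, if_true, fugacity, reduceCtorEq, if_false]
        rw [hz, div_mul_eq_mul_div, e1, div_pow]
        field_simp
      · rw [pinned_one_of_ne (by omega) _ _ _ h2, hV]
        simp only [messages, Prod.mk.injEq, h2, and_false, if_true, fugacity, if_false]
        rw [hz, e1, div_pow]
        ring
    · by_cases h2 : σ2 = one
      · subst h2
        rw [pinned_free_one (by omega), hV, hpred, hd2]
        simp only [messages, Prod.mk.injEq, reduceCtorEq, false_and, if_false, fugacity]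
        rw [hz, e2, div_pow, h31]
        field_simp
      · rw [pinned_free_of_ne (by omega) _ _ _ h2, hV, hpred, hd2]
        simp only [messages, Prod.mk.injEq, reduceCtorEq, false_and, if_false, fugacity]
        rw [hz, e2, div_pow, h31]
        field_simp
  · intro σ
    rw [sum_psiClW_mul]
    obtain ⟨σ1, σ2⟩ := σ
    simp only [messages, refl, Prod.mk.injEq]
    have hcomm : (σ2 = one ∧ σ1 = one) ↔ (σ1 = one ∧ σ2 = one) := and_comm
    by_cases h : σ1 = one ∧ σ2 = one
    · rw [if_pos h, if_pos (hcomm.mpr h), h.2]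
      field_simp
    · rw [if_neg h, if_neg (fun h' => h (hcomm.mp h'))]
      field_simp
  · simp only [BetheSymmetric, messages, Prod.mk.injEq, reduceCtorEq, and_self, and_true,
      and_false, if_false, if_true]
    field_simp
    simp

/-- Symmetry and the recursions force the clause-to-variable law to depend only on its second
coordinate. Three times that law then solves the frozen model recursions, and the clause recursion
recovers the other law. -/
theorem eq_messages {d : ℕ} {lam : ℝ} {q : Spin → ℝ} (hd : 3 ≤ d) (hlam : 1 < lam)
    (hq : IsFrozenFixedPoint d lam q) {k : Messages} (hk : IsBetheSolution d lam k)
    (hs : BetheSymmetric lam k) : k = messages lam q := by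
  have hlam0 : lam ≠ 0 := by linarith
  obtain ⟨hk1, hk2, ⟨z₁, hz₁, e₁⟩, ⟨z₂, hz₂, e₂⟩⟩ := hk
  obtain ⟨⟨s1, s2⟩, ⟨s3, s4⟩, ⟨s5, s6⟩, ⟨s7, s8⟩⟩ := hs
  have hpred : ((d - 1 : ℕ) : ℝ) = d - 1 := Nat.cast_pred (by omega)
  have hd2 : d - 1 - 1 = d - 2 := by omega
  simp only [betheSum_eq] at e₁
  simp only [sum_psiClW_mul] at e₂
  have i : Fin d := ⟨0, by omega⟩
  have p0 : ∀ η, z₁ * k.1 (zero, η) = _ := fun η =>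
    (e₁ i (zero, η)).trans (pinned_zero (by omega) _ _ _ s8.symm _)
  have p1 := (e₁ i (one, zero)).trans (pinned_one_of_ne (by omega) _ _ _ (by decide))
  have pf := (e₁ i (free, zero)).trans (pinned_free_of_ne (by omega) _ _ _ (by decide))
  have c : ∀ η η', z₂ * k.2 (η, η') = _ := fun η η' => e₂ (η, η')
  -- The case not covered by the symmetry relations: the pinned sum for an outgoing 0 does not
  -- depend on the incoming message.
  have c1 : ∀ η, k.1 (zero, η) = k.1 (zero, zero) := fun η =>
    mul_left_cancel₀ hz₁.ne' ((p0 η).trans (p0 zero).symm)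
  have cz : ∀ η, k.2 (η, zero) = k.2 (zero, zero) := by
    intro η
    apply mul_left_cancel₀ hz₂.ne'
    rw [c, c]
    simp [refl, c1 η]
  have cf : ∀ η, k.2 (η, free) = k.2 (zero, free) := by
    intro η; cases η
    · rfl
    · exact s3
    · exact s4.symm
  have co : ∀ η, k.2 (η, one) = k.2 (zero, one) := by
    intro η; cases η
    · rfl
    · exact s7
    · exact s8.symm
  have g0 := c zero zero
  have g1 := c zero one
  have gf := c zero free
  have h1 := p0 zero
  simp only [refl, Prod.mk.injEq, reduceCtorEq, false_and, if_false, one_mul] at g0 g1 gf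
  simp only [fugacity, reduceCtorEq, if_false, if_true, one_mul] at h1 p1 pf
  rw [cz one, cf one] at p1
  rw [cz free, cf free, co one] at pf
  have hsum2 := hk2.2
  rw [msg_sum, cz one, cz free, cf one, cf free, co one, co free] at hsum2
  have hV : k.2 (zero, zero) + k.2 (zero, free) = (1 - 3 * k.2 (zero, one)) / 3 := by linarith
  have hAV : k.2 (zero, one) + (1 - 3 * k.2 (zero, one)) / 3 = 1 / 3 := by ring
  rw [hV] at p1 pf h1
  rw [hAV] at h1
  rw [hpred, hd2] at h1 pf
  rw [← g0] at h1
  rw [← g1] at p1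
  rw [← gf] at pf
  rw [div_pow] at h1 p1 pf
  rw [div_pow, div_pow, one_pow] at h1
  have h31 : (3 : ℝ) ^ (d - 1) = 3 * 3 ^ (d - 2) := by
    rw [← hd2, ← pow_succ']
    congr 1
    omega
  have h3pos : (0 : ℝ) < 3 ^ (d - 2) := by positivity
  have hA1 : 3 * k.2 (zero, one) ≤ 1 := by
    have := hk2.1 (zero, zero)
    have := hk2.1 (zero, free)
    linarith
  have hD := frozenDen_pos (d := d) hlam hA1
  -- Adding the recursions for the messages 0, 1 and f identifies the product of the two unknown
  -- normalizing constants with the denominator of the frozen recursions.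
  have hW : z₁ * z₂ * 3 ^ (d - 2) = frozenDen d lam (3 * k.2 (zero, one)) := by
    have e : z₁ * (z₂ * k.2 (zero, zero)) + z₁ * (z₂ * k.2 (zero, one))
        + z₁ * (z₂ * k.2 (zero, free)) = z₁ * z₂ / 3 := by
      linear_combination z₁ * z₂ / 3 * hsum2
    rw [h1, p1, pf, h31] at e
    unfold frozenDen
    field_simp at e
    linear_combination -e
  have hp : IsFrozenFixedPoint d lam fun η => 3 * k.2 (zero, η) := by
    refine ⟨⟨fun η => mul_nonneg (by norm_num) (hk2.1 _), ?_⟩, ?_, ?_⟩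
    · rw [spin_sum]
      linarith
    · change _ = _ / frozenDen d lam (3 * k.2 (zero, one))
      rw [eq_div_iff hD.ne', ← hW]
      rw [h31] at p1
      field_simp at p1
      linear_combination p1
    · change _ = _ / frozenDen d lam (3 * k.2 (zero, one))
      rw [eq_div_iff hD.ne', ← hW]
      field_simp at pf
      linear_combination 3 * pf
  have hpq := fun η => congrFun (hq.eq hlam hp) η
  have hk : ∀ η η', k.2 (η, η') = q η' / 3 := by
    intro η η'
    rw [← hpq]
    cases η'
    · rw [cz]; ring
    · rw [co]; ring
    · rw [cf]; ring
  have h4 : k.1 (one, one) = z₂ * (q one / 3) / lam := by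
    rw [eq_div_iff hlam0, ← hk zero, g1]
    linarith
  have h5 : ∀ η' : Spin, k.1 (zero, η') = z₂ * (q zero / 3) := by
    intro η'
    rw [c1, ← g0, hk]
  have h6 : ∀ η' : Spin, k.1 (free, η') = z₂ * (q free / 3) := by
    intro η'
    have : k.1 (free, η') = k.1 (free, zero) := by
      cases η'
      · rfl
      · exact s1
      · exact s2.symm
    rw [this, ← gf, hk]
  have h7 : ∀ η' : Spin, η' ≠ one → k.1 (one, η') = z₂ * (q one / 3) := by
    intro η' h
    have : k.1 (one, η') = k.1 (one, zero) := by
      cases η'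
      · rfl
      · exact absurd rfl h
      · exact s6.symm
    rw [this, ← g1, hk]
  have hsum1 := hk1.2
  rw [msg_sum, h4, h7 _ (by decide), h7 _ (by decide)] at hsum1
  simp only [h5, h6] at hsum1
  have hN : 0 < 3 - q one + q one / lam := by
    have : 0 ≤ q one / lam := div_nonneg hq.one_nonneg (by linarith)
    linarith [hq.one_le]
  have hz : z₂ = 3 / (3 - q one + q one / lam) := by
    rw [eq_div_iff hN.ne']
    linear_combination 3 * hsum1 - 3 * z₂ * hq.sum_eq
  refine Prod.ext (funext fun σ => ?_) (funext fun σ => hk _ _)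
  obtain ⟨σ1, σ2⟩ := σ
  simp only [messages, Prod.mk.injEq]
  cases σ1
  · rw [h5, hz]
    simp
  · by_cases h : σ2 = one
    · rw [h, h4, hz]
      simp
      field_simp
    · rw [h7 _ h, hz]
      simp [h]
  · rw [h6, hz]
    simp

end FrozenModel

/-! ### Edge marginals in terms of spin densities. -/

namespace FrozenModel

open Spin

theorem rule_eq_one_iff (n : ℕ) : rule n = one ↔ n = 0 := by
  rcases n with _ | _ | n <;> simp [rule]

theorem rule_eq_free_iff (n : ℕ) : rule n = free ↔ n = 1 := by
  rcases n with _ | _ | n <;> simp [rule]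

section marginals

variable {d : ℕ}

theorem sum_varMarginal_mul (E : Emp d) (f : Msg → ℝ) :
    ∑ σ, varMarginal E σ * f σ = (d : ℝ)⁻¹ * ∑ s, E.1 s * ∑ i, f (s i) := by
  simp only [varMarginal, mul_assoc, ← Finset.mul_sum]
  congr 1
  simp only [Finset.sum_mul]
  rw [Finset.sum_comm]
  refine Finset.sum_congr rfl fun s _ => ?_
  rw [Finset.mul_sum]
  have : ∀ σ, ((Finset.univ.filter fun i => s i = σ).card : ℝ) * E.1 s * f σ
      = ∑ i, if s i = σ then E.1 s * f σ else 0 := by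
    intro σ
    rw [← Finset.sum_filter, Finset.sum_const, nsmul_eq_mul, mul_assoc]
  simp only [this]
  rw [Finset.sum_comm]
  refine Finset.sum_congr rfl fun i _ => ?_
  rw [Finset.sum_ite_eq]
  simp

theorem varMarginal_eq_sum (E : Emp d) (σ : Msg) :
    varMarginal E σ = (d : ℝ)⁻¹ * ∑ s, E.1 s * ∑ i, if s i = σ then 1 else 0 := by
  rw [← sum_varMarginal_mul E fun τ => if τ = σ then 1 else 0]
  simp

theorem sum_varMarginal (hd : 0 < d) (E : Emp d) : ∑ σ, varMarginal E σ = ∑ s, E.1 s := by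
  have h := sum_varMarginal_mul E fun _ => 1
  simp only [mul_one, Finset.sum_const, Finset.card_univ, Fintype.card_fin, nsmul_eq_mul,
    ← Finset.sum_mul] at h
  rw [h]
  have : (d : ℝ) ≠ 0 := by exact_mod_cast hd.ne'
  field_simp

theorem sum_clause_mul {E : Emp d} (hE : IsSupported E) (f : Msg × Msg → ℝ) :
    ∑ s, E.2 s * f s = ∑ σ, E.2 (σ, refl σ) * f (σ, refl σ) := by
  rw [Fintype.sum_prod_type]
  refine Finset.sum_congr rfl fun σ _ => ?_
  rw [Finset.sum_eq_single (refl σ)]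
  · intro τ _ hτ
    rw [hE.2, zero_mul]
    have : σ ≠ refl τ := fun h => hτ (by rw [h]; rfl)
    simp [psiCl, this]
  · simp

theorem clMarginal_eq {E : Emp d} (hE : IsSupported E) (σ : Msg) :
    clMarginal E σ = 2⁻¹ * (E.2 (σ, refl σ) + E.2 (refl σ, σ)) := by
  have h := sum_clause_mul hE fun s => (if s.1 = σ then 1 else 0) + (if s.2 = σ then 1 else 0)
  have h2 : clMarginal E σ = 2⁻¹ * ∑ s, E.2 s *
      ((if s.1 = σ then 1 else 0) + (if s.2 = σ then 1 else 0)) := by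
    unfold clMarginal
    simp only [mul_comm]
  rw [h2, h]
  congr 1
  simp only [mul_add, Finset.sum_add_distrib, mul_ite, mul_one, mul_zero]
  have hr : ∀ τ : Msg, refl τ = σ ↔ τ = refl σ := by
    intro τ
    constructor
    · rintro rfl; rfl
    · rintro rfl; rfl
  simp only [hr, Finset.sum_ite_eq', Finset.mem_univ, if_true]
  rfl

theorem clMarginal_refl {E : Emp d} (hE : IsSupported E) (σ : Msg) :
    clMarginal E (refl σ) = clMarginal E σ := by
  rw [clMarginal_eq hE, clMarginal_eq hE, add_comm]
  rfl

theorem sum_refl (f : Msg → ℝ) : ∑ σ, f (refl σ) = ∑ σ, f σ :=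
  (Equiv.prodComm Spin Spin).sum_comp f

theorem card_ones_cases {s : Fin d → Msg} (hs : psiVar s ≠ 0) (i : Fin d) :
    ((s i).2 = one ∧ (s i).1 = rule ((ones fun j => (s j).2).card - 1)
        ∧ 1 ≤ (ones fun j => (s j).2).card ∧ i ∈ ones fun j => (s j).2)
      ∨ ((s i).2 ≠ one ∧ (s i).1 = rule (ones fun j => (s j).2).card
        ∧ i ∉ ones fun j => (s j).2) := by
  have h := (psiVar_ne_zero_iff s).mp hs i
  by_cases hi : (s i).2 = one
  · have hmem : i ∈ ones fun j => (s j).2 := by simp [ones, hi]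
    rw [Finset.card_erase_of_mem hmem] at h
    exact Or.inl ⟨hi, h, Finset.card_pos.mpr ⟨i, hmem⟩, hmem⟩
  · have hmem : i ∉ ones fun j => (s j).2 := by simp [ones, hi]
    rw [Finset.erase_eq_of_notMem hmem] at h
    exact Or.inr ⟨hi, h, hmem⟩

theorem vertexSpin_eq (s : Fin d → Msg) :
    vertexSpin s = rule (ones fun j => (s j).2).card := rfl

/-- An edge that both sends and receives a one carries the only incoming one of its vertex; so it
occurs exactly once at a free vertex and nowhere else. -/
theorem count_one_one {s : Fin d → Msg} (hs : psiVar s ≠ 0) :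
    (∑ i, if s i = (one, one) then (1 : ℝ) else 0) = if vertexSpin s = free then 1 else 0 := by
  simp only [vertexSpin_eq, rule_eq_free_iff]
  have : ∀ i, (if s i = (one, one) then (1 : ℝ) else 0) = if i ∈ ones fun j => (s j).2 then
      (if (ones fun j => (s j).2).card = 1 then 1 else 0) else 0 := by
    intro i
    rcases card_ones_cases hs i with ⟨h2, h1, hc, hm⟩ | ⟨h2, h1, hm⟩
    · rw [if_pos hm]
      have : s i = (one, one) ↔ (ones fun j => (s j).2).card = 1 := by
        rw [Prod.ext_iff, h1, h2, rule_eq_one_iff]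
        simp only [and_true]
        omega
      simp only [this]
    · rw [if_neg hm, if_neg]
      intro h
      exact h2 (by rw [h])
  simp only [this, Finset.sum_ite_mem, Finset.univ_inter, Finset.sum_const, nsmul_eq_mul]
  split_ifs with h <;> simp [h]

theorem count_one {s : Fin d → Msg} (hs : psiVar s ≠ 0) :
    (∑ i, if s i = (one, zero) then (1 : ℝ) else 0) + (∑ i, if s i = (one, free) then 1 else 0)
      = d * if vertexSpin s = one then 1 else 0 := by
  simp only [vertexSpin_eq, rule_eq_one_iff, ← Finset.sum_add_distrib]
  have : ∀ i, ((if s i = (one, zero) then (1 : ℝ) else 0) + if s i = (one, free) then 1 else 0)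
      = if (ones fun j => (s j).2).card = 0 then 1 else 0 := by
    intro i
    rcases card_ones_cases hs i with ⟨h2, h1, hc, hm⟩ | ⟨h2, h1, hm⟩
    · have : (ones fun j => (s j).2).card ≠ 0 := by omega
      simp [Prod.ext_iff, h2, this]
    · cases h : (s i).2
      · simp [Prod.ext_iff, h, h1, rule_eq_one_iff]
      · exact absurd h h2
      · simp [Prod.ext_iff, h, h1, rule_eq_one_iff]
  simp only [this, Finset.sum_const, Finset.card_univ, Fintype.card_fin, nsmul_eq_mul]

/-- At a free vertex all edges but the one with the incoming one send f. At other vertices f is sent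
only along edges that receive a one. -/
theorem count_free {s : Fin d → Msg} (hs : psiVar s ≠ 0) :
    (∑ i, if s i = (free, zero) then (1 : ℝ) else 0)
      + (∑ i, if s i = (free, free) then 1 else 0)
      = (d - 1) * if vertexSpin s = free then 1 else 0 := by
  simp only [vertexSpin_eq, rule_eq_free_iff, ← Finset.sum_add_distrib]
  have : ∀ i, ((if s i = (free, zero) then (1 : ℝ) else 0)
      + if s i = (free, free) then 1 else 0)
      = (if (ones fun j => (s j).2).card = 1 then 1 else 0)
        - if i ∈ ones fun j => (s j).2 then
            (if (ones fun j => (s j).2).card = 1 then 1 else 0) else 0 := by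
    intro i
    rcases card_ones_cases hs i with ⟨h2, h1, hc, hm⟩ | ⟨h2, h1, hm⟩
    · simp [Prod.ext_iff, h2, hm]
    · cases h : (s i).2
      · simp [Prod.ext_iff, h, h1, rule_eq_free_iff, hm]
      · exact absurd h h2
      · simp [Prod.ext_iff, h, h1, rule_eq_free_iff, hm]
  simp only [this, Finset.sum_sub_distrib, Finset.sum_ite_mem, Finset.univ_inter,
    Finset.sum_const, nsmul_eq_mul, Finset.card_univ, Fintype.card_fin]
  split_ifs with h <;> simp [h]

variable {E : Emp d}

theorem sum_mul_congr (hE : IsSupported E) {f g : (Fin d → Msg) → ℝ}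
    (h : ∀ s, psiVar s ≠ 0 → f s = g s) : ∑ s, E.1 s * f s = ∑ s, E.1 s * g s := by
  refine Finset.sum_congr rfl fun s _ => ?_
  by_cases hs : psiVar s = 0
  · rw [hE.1 s hs, zero_mul, zero_mul]
  · rw [h s hs]

theorem density_eq (E : Emp d) (η : Spin) :
    density E η = ∑ s, E.1 s * if vertexSpin s = η then 1 else 0 := by
  simp only [density, mul_ite, mul_one, mul_zero]

theorem sum_density (E : Emp d) :
    density E zero + density E one + density E free = ∑ s, E.1 s := by
  simp only [density_eq, ← Finset.sum_add_distrib]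
  refine Finset.sum_congr rfl fun s _ => ?_
  cases vertexSpin s <;> simp

theorem varMarginal_one_one (hd : 0 < d) (hE : IsSupported E) :
    d * varMarginal E (one, one) = density E free := by
  have : (d : ℝ) ≠ 0 := by exact_mod_cast hd.ne'
  rw [varMarginal_eq_sum, density_eq, sum_mul_congr hE fun s hs => count_one_one hs]
  field_simp

theorem varMarginal_one (hd : 0 < d) (hE : IsSupported E) :
    varMarginal E (one, zero) + varMarginal E (one, free) = density E one := by
  have : (d : ℝ) ≠ 0 := by exact_mod_cast hd.ne'
  rw [varMarginal_eq_sum, varMarginal_eq_sum, density_eq, ← mul_add, ← Finset.sum_add_distrib]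
  simp only [← mul_add]
  rw [sum_mul_congr hE fun s hs => count_one hs, Finset.mul_sum]
  refine Finset.sum_congr rfl fun s _ => ?_
  field_simp

theorem varMarginal_free (hd : 0 < d) (hE : IsSupported E) :
    varMarginal E (free, zero) + varMarginal E (free, free)
      = (1 - 1 / d) * density E free := by
  have : (d : ℝ) ≠ 0 := by exact_mod_cast hd.ne'
  rw [varMarginal_eq_sum, varMarginal_eq_sum, density_eq, ← mul_add, ← Finset.sum_add_distrib]
  simp only [← mul_add]
  rw [sum_mul_congr hE fun s hs => count_free hs, Finset.mul_sum, Finset.mul_sum]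
  refine Finset.sum_congr rfl fun s _ => ?_
  field_simp

end marginals

end FrozenModel

/-! ### The stationary point attached to the symmetric solution. -/

namespace FrozenModel

open Spin

/-- The normalized edge law of the symmetric solution. -/
noncomputable def edgeNorm (lam r : ℝ) : ℝ := 1 - r ^ 2 + r ^ 2 / lam

/-- The edge marginal of the symmetric solution. -/
noncomputable def edgeLaw (lam : ℝ) (q : Spin → ℝ) (σ : Msg) : ℝ :=
  (if σ = (one, one) then q one * q one / lam else q σ.1 * q σ.2) / edgeNorm lam (q one)

/-- The normalizing constant of the variable measure of the symmetric solution. -/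
noncomputable def vertexNorm (d : ℕ) (r : ℝ) : ℝ := 1 + r - (1 - r) ^ (d - 1)

/-- The pair of empirical measures of the symmetric solution. -/
noncomputable def empirical (d : ℕ) (lam : ℝ) (q : Spin → ℝ) : Emp d :=
  (fun s => psiVarW lam s * (∏ i, q (s i).2) / vertexNorm d (q one),
    fun s => psiCl s * edgeLaw lam q s.1)

theorem edgeLaw_refl (lam : ℝ) (q : Spin → ℝ) (σ : Msg) :
    edgeLaw lam q (refl σ) = edgeLaw lam q σ := by
  obtain ⟨a, b⟩ := σ
  unfold edgeLaw refl
  simp only [Prod.mk.injEq, and_comm, mul_comm]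

theorem isSupported_empirical (d : ℕ) (lam : ℝ) (q : Spin → ℝ) :
    IsSupported (empirical d lam q) := by
  refine ⟨fun s hs => ?_, fun s hs => ?_⟩
  · simp [empirical, psiVarW, hs]
  · simp [empirical, hs]

theorem clMarginal_empirical (d : ℕ) (lam : ℝ) (q : Spin → ℝ) (σ : Msg) :
    clMarginal (empirical d lam q) σ = edgeLaw lam q σ := by
  rw [clMarginal_eq (isSupported_empirical d lam q)]
  simp only [empirical, psiCl, edgeLaw_refl]
  simp [refl]
  ring

section

variable {d : ℕ} {lam : ℝ} {q : Spin → ℝ} (hq : IsFrozenFixedPoint d lam q) (hd : 3 ≤ d)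
  (hlam : 1 < lam)

include hq hlam

/-- This expresses λ through the mass of q at 1. It is used below to eliminate λ and, at the end, to
recover it. -/
theorem fugacity_relation :
    lam * (1 - q one) ^ (d - 1) * (1 - q one) = q one * (1 - (1 - q one) ^ (d - 1)) := by
  have := hq.one_mul_den hlam
  unfold frozenDen at this
  linear_combination -this

theorem frozenDen_eq : frozenDen d lam (q one) * (1 - q one) = 1 - (1 - q one) ^ (d - 1) := by
  have := fugacity_relation hq hlam
  unfold frozenDen
  linear_combination this

theorem edgeNorm_eq : edgeNorm lam (q one) * frozenDen d lam (q one) = vertexNorm d (q one) := by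
  have h := fugacity_relation hq hlam
  have h1 := hq.one_mul_den hlam
  have h2 := frozenDen_eq hq hlam
  have hl : lam ≠ 0 := by linarith
  have h3 : q one ^ 2 / lam * frozenDen d lam (q one) = q one * (1 - q one) ^ (d - 1) := by
    rw [div_mul_eq_mul_div, pow_two, mul_assoc, h1]
    field_simp
  unfold edgeNorm vertexNorm
  rw [add_mul, h3]
  linear_combination (1 + q one) * h2

include hd

theorem pow_pos_lt_one : 0 < (1 - q one) ^ (d - 1) ∧ (1 - q one) ^ (d - 1) < 1 := by
  have h0 := hq.one_pos hlam
  have h1 := hq.one_lt hd hlam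
  exact ⟨pow_pos (by linarith) _, pow_lt_one₀ (by linarith) (by linarith) (by omega)⟩

theorem vertexNorm_pos : 0 < vertexNorm d (q one) := by
  have h0 := hq.one_pos hlam
  have := pow_pos_lt_one hq hd hlam
  unfold vertexNorm
  linarith

theorem edgeNorm_pos : 0 < edgeNorm lam (q one) := by
  have h0 := hq.one_pos hlam
  have h1 := hq.one_lt hd hlam
  have : 0 < q one ^ 2 / lam := by positivity
  unfold edgeNorm
  nlinarith

theorem edgeLaw_pos (σ : Msg) : 0 < edgeLaw lam q σ := by
  have hp := hq.pos hd hlam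
  refine div_pos ?_ (edgeNorm_pos hq hd hlam)
  split_ifs
  · exact div_pos (mul_pos (hp _) (hp _)) (by linarith)
  · exact mul_pos (hp _) (hp _)

theorem sum_edgeLaw : ∑ σ, edgeLaw lam q σ = 1 := by
  have hs := hq.sum_eq
  rw [msg_sum]
  simp only [edgeLaw, Prod.mk.injEq, reduceCtorEq, and_self, and_true, and_false, if_false,
    if_true, ← add_div]
  rw [div_eq_one_iff_eq (edgeNorm_pos hq hd hlam).ne', edgeNorm]
  have : q zero = 1 - q one - q free := by linarith
  rw [this]
  ring

/-- Restoring the weight of the pinned edge turns the pinned sum into the unnormalized edge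
marginal. The two normalizations match by `edgeNorm_eq`. -/
theorem mul_pinned_eq (i : Fin d) (σ : Msg) :
    q σ.2 * pinned (fugacity lam) (fun τ => q τ.2) i σ
      = vertexNorm d (q one) * edgeLaw lam q σ := by
  have e1 := hq.one_mul_den hlam
  have e2 := hq.free_mul_den hlam
  have e3 := hq.zero_mul_den hlam
  have hx : q zero + q free = 1 - q one := by linarith [hq.sum_eq]
  have hs : q one + (q zero + q free) = 1 := by linarith [hq.sum_eq]
  have hpred : ((d - 1 : ℕ) : ℝ) = d - 1 := Nat.cast_pred (by omega)
  have hd2 : d - 1 - 1 = d - 2 := by omega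
  have hl : lam ≠ 0 := by linarith
  have hE := edgeNorm_pos hq hd hlam
  have hz : ∀ c : ℝ, vertexNorm d (q one) * (c / edgeNorm lam (q one))
      = c * frozenDen d lam (q one) := by
    intro c
    rw [← edgeNorm_eq hq hlam]
    field_simp
  rw [edgeLaw, hz]
  obtain ⟨σ1, σ2⟩ := σ
  cases σ1
  · rw [pinned_zero (by omega) _ _ _ rfl, hpred, hd2, hs, hx, one_pow]
    simp only [Prod.mk.injEq, reduceCtorEq, false_and, if_false, fugacity]
    linear_combination -q σ2 * e3
  · by_cases h2 : σ2 = one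
    · subst h2
      rw [pinned_one_one (by omega), hx]
      simp only [if_true, fugacity, reduceCtorEq, if_false]
      field_simp
      linear_combination -q one * e1
    · rw [pinned_one_of_ne (by omega) _ _ _ h2, hx]
      simp only [Prod.mk.injEq, h2, and_false, if_true, fugacity, if_false]
      linear_combination -q σ2 * e1
  · by_cases h2 : σ2 = one
    · subst h2
      rw [pinned_free_one (by omega), hpred, hd2, hx]
      simp only [Prod.mk.injEq, reduceCtorEq, false_and, if_false, fugacity]
      linear_combination -q one * e2
    · rw [pinned_free_of_ne (by omega) _ _ _ h2, hpred, hd2, hx]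
      simp only [Prod.mk.injEq, reduceCtorEq, false_and, if_false, fugacity]
      linear_combination -q σ2 * e2

theorem varMarginal_empirical (σ : Msg) :
    varMarginal (empirical d lam q) σ = edgeLaw lam q σ := by
  have hZ := vertexNorm_pos hq hd hlam
  have hd0 : (d : ℝ) ≠ 0 := by exact_mod_cast (by omega : d ≠ 0)
  rw [varMarginal_eq_sum]
  simp only [Finset.mul_sum, mul_ite, mul_one, mul_zero]
  rw [Finset.sum_comm]
  have : ∀ i : Fin d, (∑ s : Fin d → Msg, if s i = σ then (d : ℝ)⁻¹ * (empirical d lam q).1 s else 0)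
      = (d : ℝ)⁻¹ * edgeLaw lam q σ := by
    intro i
    rw [← Finset.sum_filter, ← Finset.mul_sum]
    congr 1
    apply mul_left_cancel₀ hZ.ne'
    rw [← mul_pinned_eq hq hd hlam i, pinned, Finset.mul_sum, Finset.mul_sum]
    refine Finset.sum_congr rfl fun s hs => ?_
    have hsi : s i = σ := (Finset.mem_filter.mp hs).2
    simp only [empirical]
    rw [← Finset.mul_prod_erase Finset.univ _ (Finset.mem_univ i), hsi, psiVarW, fugacity]
    field_simp
  simp only [this, Finset.sum_const, Finset.card_univ, Fintype.card_fin, nsmul_eq_mul]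
  field_simp

theorem isBalanced_empirical : IsBalanced (empirical d lam q) := by
  have hsup := isSupported_empirical d lam q
  refine ⟨hsup, fun s => ?_, fun s => ?_, ?_, ?_, fun σ => ?_⟩
  · refine div_nonneg (mul_nonneg ?_ ?_) (vertexNorm_pos hq hd hlam).le
    · refine mul_nonneg (psiVar_nonneg s) ?_
      split_ifs <;> linarith
    · exact Finset.prod_nonneg fun i _ => (hq.pos hd hlam _).le
  · refine mul_nonneg ?_ (edgeLaw_pos hq hd hlam _).le
    unfold psiCl
    split_ifs <;> norm_num
  · rw [← sum_varMarginal (by omega), ← sum_edgeLaw hq hd hlam]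
    simp only [varMarginal_empirical hq hd hlam]
  · have := sum_clause_mul hsup fun _ => 1
    simp only [mul_one] at this
    rw [this, ← sum_edgeLaw hq hd hlam]
    refine Finset.sum_congr rfl fun σ _ => ?_
    simp [empirical, psiCl, refl]
  · rw [varMarginal_empirical hq hd hlam, clMarginal_empirical]

theorem empirical_fst_pos {s : Fin d → Msg} (hs : psiVar s ≠ 0) :
    0 < (empirical d lam q).1 s := by
  refine div_pos (mul_pos ?_ (Finset.prod_pos fun i _ => hq.pos hd hlam _))
    (vertexNorm_pos hq hd hlam)
  rw [psiVarW, psiVar_of_ne hs, one_mul]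
  split_ifs <;> linarith

theorem isPositive_empirical : IsPositive (empirical d lam q) := by
  refine ⟨fun s hs => empirical_fst_pos hq hd hlam hs, fun s hs => ?_⟩
  refine mul_pos ?_ (edgeLaw_pos hq hd hlam _)
  unfold psiCl at *
  split_ifs at *
  · norm_num
  · exact absurd rfl hs

theorem log_empirical_fst {s : Fin d → Msg} (hs : psiVar s ≠ 0) :
    Real.log ((empirical d lam q).1 s) = (if vertexSpin s = one then 1 else 0) * Real.log lam
      + ∑ i, Real.log (q (s i).2) - Real.log (vertexNorm d (q one)) := by
  have hp := hq.pos hd hlam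
  have hprod : (∏ i, q (s i).2) ≠ 0 := Finset.prod_ne_zero_iff.mpr fun i _ => (hp _).ne'
  have hl : lam ≠ 0 := by linarith
  simp only [empirical, psiVarW, psiVar_of_ne hs, one_mul]
  rw [Real.log_div _ (vertexNorm_pos hq hd hlam).ne', Real.log_mul _ hprod,
    Real.log_prod fun i _ => (hp _).ne']
  · split_ifs <;> simp
  · split_ifs
    · exact hl
    · norm_num
  · refine mul_ne_zero ?_ hprod
    split_ifs
    · exact hl
    · norm_num

theorem log_edgeLaw (σ : Msg) :
    Real.log (edgeLaw lam q σ) = Real.log (q σ.1) + Real.log (q σ.2)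
      - (if σ = (one, one) then 1 else 0) * Real.log lam - Real.log (edgeNorm lam (q one)) := by
  have hp := fun η => (hq.pos hd hlam η).ne'
  have hl : lam ≠ 0 := by linarith
  have hE := (edgeNorm_pos hq hd hlam).ne'
  unfold edgeLaw
  split_ifs with h
  · subst h
    rw [Real.log_div (div_ne_zero (mul_ne_zero (hp _) (hp _)) hl) hE,
      Real.log_div (mul_ne_zero (hp _) (hp _)) hl, Real.log_mul (hp _) (hp _)]
    ring
  · rw [Real.log_div (mul_ne_zero (hp _) (hp _)) hE, Real.log_mul (hp _) (hp _)]
    ring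

/-- The linear functional given by the logarithms of the symmetric solution. -/
theorem sum_log_empirical {E : Emp d} (hE : IsSupported E)
    (hm : ∀ σ, varMarginal E σ = clMarginal E σ) :
    ∑ s, E.1 s * Real.log ((empirical d lam q).1 s)
      + d / 2 * ∑ s, E.2 s * Real.log ((empirical d lam q).2 s)
      - d * ∑ σ, varMarginal E σ * Real.log (varMarginal (empirical d lam q) σ)
    = intensity E * Real.log lam - (∑ s, E.1 s) * (Real.log (vertexNorm d (q one))
        - d / 2 * Real.log (edgeNorm lam (q one))) := by
  have hd0 : (d : ℝ) ≠ 0 := by exact_mod_cast (by omega : d ≠ 0)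
  have h1 : ∑ s, E.1 s * Real.log ((empirical d lam q).1 s)
      = density E one * Real.log lam + d * ∑ σ, varMarginal E σ * Real.log (q σ.2)
        - (∑ s, E.1 s) * Real.log (vertexNorm d (q one)) := by
    rw [sum_mul_congr hE fun s hs => log_empirical_fst hq hd hlam hs, sum_varMarginal_mul,
      density_eq]
    simp only [mul_sub, mul_add, Finset.sum_sub_distrib, Finset.sum_add_distrib, Finset.sum_mul]
    rw [mul_inv_cancel_left₀ hd0]
    simp only [mul_assoc]
  have hsym : ∀ σ, varMarginal E (refl σ) = varMarginal E σ := by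
    intro σ
    rw [hm, hm, clMarginal_refl hE]
  have h2 : ∑ s, E.2 s * Real.log ((empirical d lam q).2 s)
      = ∑ σ, varMarginal E σ * Real.log (edgeLaw lam q σ) := by
    rw [sum_clause_mul hE]
    have e1 : ∀ σ, (empirical d lam q).2 (σ, refl σ) = edgeLaw lam q σ := by
      intro σ
      simp [empirical, psiCl, refl]
    simp only [e1]
    have e2 := sum_refl fun σ => E.2 (σ, refl σ) * Real.log (edgeLaw lam q σ)
    simp only [edgeLaw_refl] at e2
    simp only [hm, clMarginal_eq hE]
    have e3 : ∀ σ, 2⁻¹ * (E.2 (σ, refl σ) + E.2 (refl σ, σ)) * Real.log (edgeLaw lam q σ)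
      = 2⁻¹ * (E.2 (σ, refl σ) * Real.log (edgeLaw lam q σ))
        + 2⁻¹ * (E.2 (refl σ, refl (refl σ)) * Real.log (edgeLaw lam q σ)) := by
      intro σ
      have : refl (refl σ) = σ := rfl
      rw [this]
      ring
    simp only [e3, Finset.sum_add_distrib, ← Finset.mul_sum, e2]
    ring
  have h3 : ∑ σ, varMarginal E σ * Real.log (edgeLaw lam q σ)
      = 2 * ∑ σ, varMarginal E σ * Real.log (q σ.2) - varMarginal E (one, one) * Real.log lam
        - (∑ s, E.1 s) * Real.log (edgeNorm lam (q one)) := by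
    have e2 := sum_refl fun σ => varMarginal E σ * Real.log (q σ.2)
    simp only [hsym] at e2
    rw [← sum_varMarginal (by omega) E]
    simp only [log_edgeLaw hq hd hlam, mul_sub, mul_add, Finset.sum_sub_distrib,
      Finset.sum_add_distrib, Finset.sum_mul]
    simp only [ite_mul, mul_ite, zero_mul, mul_zero, one_mul, Finset.sum_ite_eq',
      Finset.mem_univ, if_true]
    have e3 : ∀ σ : Msg, (refl σ).2 = σ.1 := fun _ => rfl
    simp only [e3] at e2
    rw [← e2]
    ring
  simp only [varMarginal_empirical hq hd hlam]
  -- The sum of log q over edges enters with coefficients d, d and −2d, and so cancels. The factor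
  -- 1/λ on (1,1) edges supplies the half weight of free vertices in the intensity.
  rw [h1, h2, h3, intensity, ← varMarginal_one_one (by omega) hE]
  ring

end

theorem mul_log_indicator_div {ψ x : ℝ} (h : ψ = 0 → x = 0) (h1 : ψ ≠ 0 → ψ = 1) :
    x * Real.log (ψ / x) = Real.negMulLog x := by
  by_cases hψ : ψ = 0
  · rw [h hψ]; simp
  · rw [h1 hψ, Real.negMulLog, one_div, Real.log_inv]
    ring

theorem psiCl_of_ne {s : Msg × Msg} (h : psiCl s ≠ 0) : psiCl s = 1 := by
  unfold psiCl at *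
  split_ifs at * with h1
  · rfl
  · exact absurd rfl h

theorem rate_eq {d : ℕ} {E : Emp d} (hE : IsSupported E) :
    rate E = ∑ s, Real.negMulLog (E.1 s) + d / 2 * ∑ s, Real.negMulLog (E.2 s)
      - d * ∑ σ, Real.negMulLog (varMarginal E σ) := by
  unfold rate
  congr 1
  · congr 1
    · exact Finset.sum_congr rfl fun s _ =>
        mul_log_indicator_div (hE.1 s) psiVar_of_ne
    · congr 1
      exact Finset.sum_congr rfl fun s _ =>
        mul_log_indicator_div (hE.2 s) psiCl_of_ne
  · congr 1
    exact Finset.sum_congr rfl fun σ _ =>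
      mul_log_indicator_div (fun h => absurd h one_ne_zero) fun _ => rfl

/-- x log x is not differentiable at 0, so a vanishing coordinate is required not to move. -/
theorem hasDerivAt_negMulLog_line {x v : ℝ} (h : x = 0 → v = 0) :
    HasDerivAt (fun t : ℝ => Real.negMulLog (x + t * v)) (-(v * Real.log x) - v) 0 := by
  by_cases hx : x = 0
  · rw [hx, h hx]
    simpa using hasDerivAt_const (0 : ℝ) (0 : ℝ)
  · have h1 : HasDerivAt (fun t : ℝ => x + t * v) v 0 := by
      simpa using ((hasDerivAt_id (0 : ℝ)).mul_const v).const_add x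
    have h2 : HasDerivAt Real.negMulLog (-Real.log x - 1) (x + 0 * v) := by
      simpa using Real.hasDerivAt_negMulLog hx
    have h3 := h2.comp (0 : ℝ) h1
    exact h3.congr_deriv (by ring)

theorem varMarginal_add_smul {d : ℕ} (E D : Emp d) (t : ℝ) (σ : Msg) :
    varMarginal (E + t • D) σ = varMarginal E σ + t * varMarginal D σ := by
  simp only [varMarginal_eq_sum, Prod.fst_add, Prod.smul_fst, Pi.add_apply, Pi.smul_apply,
    smul_eq_mul, add_mul, Finset.sum_add_distrib, mul_assoc, ← Finset.mul_sum]
  ring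

theorem intensity_add_smul {d : ℕ} (E D : Emp d) (t : ℝ) :
    intensity (E + t • D) = intensity E + t * intensity D := by
  simp only [intensity, density_eq, Prod.fst_add, Prod.smul_fst, Pi.add_apply, Pi.smul_apply,
    smul_eq_mul, add_mul, Finset.sum_add_distrib, mul_assoc, ← Finset.mul_sum]
  ring

section

variable {d : ℕ} {lam : ℝ} {q : Spin → ℝ} (hq : IsFrozenFixedPoint d lam q) (hd : 3 ≤ d)
  (hlam : 1 < lam)

include hq hd hlam

theorem isStationary_empirical : IsStationary lam (empirical d lam q) := by
  have hb := isBalanced_empirical hq hd hlam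
  have hp := isPositive_empirical hq hd hlam
  refine ⟨hb, hp, fun D hD => ?_⟩
  obtain ⟨hDs, hD1, hD2, hDm⟩ := hD
  have hsup : ∀ t : ℝ, IsSupported (empirical d lam q + t • D) := fun t =>
    ⟨fun s hs => by simp [hb.1.1 s hs, hDs.1 s hs], fun s hs => by
      simp [hb.1.2 s hs, hDs.2 s hs]⟩
  have hfun : (fun t : ℝ => rateW lam (empirical d lam q + t • D)) = fun t : ℝ =>
      ∑ s, Real.negMulLog ((empirical d lam q).1 s + t * D.1 s)
        + d / 2 * ∑ s, Real.negMulLog ((empirical d lam q).2 s + t * D.2 s)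
        - d * ∑ σ, Real.negMulLog (varMarginal (empirical d lam q) σ + t * varMarginal D σ)
        + (intensity (empirical d lam q) + t * intensity D) * Real.log lam := by
    funext t
    rw [rateW, rate_eq (hsup t), intensity_add_smul]
    simp only [varMarginal_add_smul]
    rfl
  rw [hfun]
  have d1 := HasDerivAt.fun_sum (u := Finset.univ) fun (s : Fin d → Msg) _ =>
    hasDerivAt_negMulLog_line (x := (empirical d lam q).1 s) (v := D.1 s) fun h => by
      by_contra hc
      exact (hp.1 s fun hψ => hc (hDs.1 s hψ)).ne' h
  have d2 := HasDerivAt.fun_sum (u := Finset.univ) fun (s : Msg × Msg) _ =>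
    hasDerivAt_negMulLog_line (x := (empirical d lam q).2 s) (v := D.2 s) fun h => by
      by_contra hc
      exact (hp.2 s fun hψ => hc (hDs.2 s hψ)).ne' h
  have d3 := HasDerivAt.fun_sum (u := Finset.univ) fun (σ : Msg) _ =>
    hasDerivAt_negMulLog_line (x := varMarginal (empirical d lam q) σ) (v := varMarginal D σ)
      fun h => by
        rw [varMarginal_empirical hq hd hlam] at h
        exact absurd h (edgeLaw_pos hq hd hlam σ).ne'
  have d4 : HasDerivAt (fun t : ℝ => (intensity (empirical d lam q) + t * intensity D)
      * Real.log lam) (intensity D * Real.log lam) 0 := by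
    simpa using (((hasDerivAt_id (0 : ℝ)).mul_const (intensity D)).const_add
      (intensity (empirical d lam q))).mul_const (Real.log lam)
  -- A tangent direction has mass zero, so only intensity · log λ survives, which cancels the
  -- derivative of the fugacity term.
  have key := sum_log_empirical hq hd hlam hDs hDm
  refine (((d1.add (d2.const_mul (d / 2 : ℝ))).sub (d3.const_mul (d : ℝ))).add d4).congr_deriv ?_
  simp only [Finset.sum_sub_distrib, Finset.sum_neg_distrib, hD1, hD2,
    sum_varMarginal (by omega : 0 < d)]
  rw [hD1] at key
  linear_combination -key

theorem corresponds_empirical : Corresponds lam (messages lam q) (empirical d lam q) := by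
  have hZ := vertexNorm_pos hq hd hlam
  have hE := edgeNorm_pos hq hd hlam
  have hl : lam ≠ 0 := by linarith
  have hN : 0 < 3 - q one + q one / lam := by
    have : 0 ≤ q one / lam := div_nonneg hq.one_nonneg (by linarith)
    linarith [hq.one_le]
  refine ⟨⟨vertexNorm d (q one) / 3 ^ d, by positivity, fun s => ?_⟩,
    ⟨edgeNorm lam (q one) / (3 - q one + q one / lam) ^ 2, by positivity, fun s => ?_⟩,
    ⟨edgeNorm lam (q one) / (3 * (3 - q one + q one / lam)), by positivity, fun σ => ?_⟩⟩
  · simp only [messages, empirical, Finset.prod_div_distrib, Finset.prod_const,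
      Finset.card_univ, Fintype.card_fin]
    field_simp
  · obtain ⟨σ, τ⟩ := s
    simp only [empirical, psiClW]
    by_cases h : σ = refl τ
    · have hτ : τ = refl σ := by rw [h]; rfl
      subst hτ
      have e1 : psiCl (σ, refl σ) = 1 := by simp [psiCl, refl]
      rw [e1]
      simp only [messages]
      generalize 3 - q one + q one / lam = N at *
      obtain ⟨a, b⟩ := σ
      by_cases hab : a = one ∧ b = one
      · obtain ⟨rfl, rfl⟩ := hab
        have hN0 := hN.ne'
        simp [edgeLaw, refl]
        field_simp
      · have hba : ¬ (b = one ∧ a = one) := fun h => hab h.symm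
        simp only [edgeLaw, refl, Prod.mk.injEq, hab, hba, if_false]
        field_simp
    · have e0 : psiCl (σ, τ) = 0 := by simp [psiCl, h]
      rw [e0]
      ring
  · rw [varMarginal_empirical hq hd hlam, edgeLaw]
    obtain ⟨a, b⟩ := σ
    by_cases hab : a = one ∧ b = one
    · obtain ⟨rfl, rfl⟩ := hab
      simp only [messages, if_true]
      field_simp
    · simp only [messages, Prod.mk.injEq, hab, if_false]
      field_simp

theorem eq_empirical {K : Emp d} (hK : IsBalanced K) (hc : Corresponds lam (messages lam q) K) :
    K = empirical d lam q := by
  obtain ⟨⟨z, hz, e⟩, ⟨z', hz', e'⟩, -⟩ := hc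
  obtain ⟨⟨y, hy, f⟩, ⟨y', hy', f'⟩, -⟩ := corresponds_empirical hq hd hlam
  have hb := isBalanced_empirical hq hd hlam
  have g : ∀ s, z * K.1 s = y * (empirical d lam q).1 s := fun s => (e s).trans (f s).symm
  have g' : ∀ s, z' * K.2 s = y' * (empirical d lam q).2 s := fun s => (e' s).trans (f' s).symm
  have hzy : z = y := by
    have := Finset.sum_congr (rfl : Finset.univ = Finset.univ) fun s _ => g s
    rwa [← Finset.mul_sum, ← Finset.mul_sum, hK.2.2.2.1, hb.2.2.2.1, mul_one, mul_one] at this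
  have hzy' : z' = y' := by
    have := Finset.sum_congr (rfl : Finset.univ = Finset.univ) fun s _ => g' s
    rwa [← Finset.mul_sum, ← Finset.mul_sum, hK.2.2.2.2.1, hb.2.2.2.2.1, mul_one, mul_one] at this
  refine Prod.ext (funext fun s => ?_) (funext fun s => ?_)
  · have := g s
    rw [hzy] at this
    exact mul_left_cancel₀ hy.ne' this
  · have := g' s
    rw [hzy'] at this
    exact mul_left_cancel₀ hy'.ne' this

theorem rate_empirical :
    rate (empirical d lam q) = Real.log (vertexNorm d (q one))
      - d / 2 * Real.log (edgeNorm lam (q one))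
      - intensity (empirical d lam q) * Real.log lam := by
  have hb := isBalanced_empirical hq hd hlam
  have key := sum_log_empirical hq hd hlam hb.1 hb.2.2.2.2.2
  rw [hb.2.2.2.1] at key
  rw [rate_eq hb.1]
  simp only [Real.negMulLog, neg_mul, Finset.sum_neg_distrib]
  linear_combination -key

end

end FrozenModel

/-! ### Entropy bound for the rate function at given spin densities. -/

namespace FrozenModel

open Spin

theorem sub_le_mul_log_sub {x w : ℝ} (hx : 0 ≤ x) (hw : 0 ≤ w) (h : w = 0 → x = 0) :
    x - w ≤ x * (Real.log x - Real.log w) := by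
  rcases hx.eq_or_lt with rfl | hx
  · simpa using hw
  · have hw : 0 < w := lt_of_le_of_ne hw fun h0 => hx.ne' (h h0.symm)
    have := Real.log_le_sub_one_of_pos (div_pos hw hx)
    rw [Real.log_div hw.ne' hx.ne'] at this
    have h2 := mul_le_mul_of_nonneg_left this hx.le
    have h3 : x * (w / x - 1) = w - x := by field_simp
    linarith

theorem eq_of_mul_log_sub_le {x w : ℝ} (hx : 0 ≤ x) (hw : 0 ≤ w) (h : w = 0 → x = 0)
    (hle : x * (Real.log x - Real.log w) ≤ x - w) : x = w := by
  rcases hx.eq_or_lt with rfl | hx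
  · simp at hle
    linarith
  · have hw : 0 < w := lt_of_le_of_ne hw fun h0 => hx.ne' (h h0.symm)
    by_contra hne
    have := Real.log_lt_sub_one_of_pos (div_pos hw hx) fun h1 => hne
      ((div_eq_one_iff_eq hx.ne').mp h1).symm
    rw [Real.log_div hw.ne' hx.ne'] at this
    have h2 := mul_lt_mul_of_pos_left this hx
    have h3 : x * (w / x - 1) = w - x := by field_simp
    linarith

theorem gibbs {ι : Type*} [Fintype ι] {x w : ι → ℝ} (hx : ∀ i, 0 ≤ x i) (hw : ∀ i, 0 ≤ w i)
    (h : ∀ i, w i = 0 → x i = 0) (hs : ∑ i, x i = ∑ i, w i) :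
    0 ≤ ∑ i, x i * (Real.log (x i) - Real.log (w i)) ∧
      (∑ i, x i * (Real.log (x i) - Real.log (w i)) ≤ 0 → ∀ i, x i = w i) := by
  have h1 : ∑ i, (x i - w i) = 0 := by rw [Finset.sum_sub_distrib, hs, sub_self]
  have h2 : ∀ i ∈ Finset.univ, x i - w i ≤ x i * (Real.log (x i) - Real.log (w i)) :=
    fun i _ => sub_le_mul_log_sub (hx i) (hw i) (h i)
  have h3 := Finset.sum_le_sum h2
  rw [h1] at h3
  refine ⟨h3, fun h4 i => ?_⟩
  have h5 := (Finset.sum_eq_sum_iff_of_le h2).mp (by rw [h1]; exact le_antisymm h3 h4)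
  exact eq_of_mul_log_sub_le (hx i) (hw i) (h i) (h5 i (Finset.mem_univ i)).ge

theorem mul_log_div {x p : ℝ} (h : p = 0 → x = 0) :
    x * Real.log (x / p) = x * Real.log x - x * Real.log p := by
  by_cases hx : x = 0
  · simp [hx]
  · rw [Real.log_div hx fun hp => hx (h hp)]
    ring

theorem mul_log_mul_div {c x p : ℝ} (hc : c ≠ 0) (h : p = 0 → x = 0) :
    x * Real.log (c * x / p) = x * Real.log c + (x * Real.log x - x * Real.log p) := by
  by_cases hx : x = 0
  · simp [hx]
  · rw [mul_div_assoc, Real.log_mul hc (div_ne_zero hx fun hp => hx (h hp)), mul_add,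
      mul_log_div h]

/-- The expression is the relative entropy of the symmetric table with rows (g, e) and (e, k) with
respect to the product of its margins B, m; it vanishes only under independence. It is applied to
edges with both messages in {0, f}. -/
theorem two_by_two_entropy {e g k B m : ℝ} (he : 0 ≤ e) (hg : 0 ≤ g) (hk : 0 ≤ k)
    (h1 : e + g = B) (h2 : e + k = m) (hm : 0 < m) :
    0 ≤ 2 * (e * Real.log e) + g * Real.log g + k * Real.log k - 2 * (B * Real.log B)
        - 2 * (m * Real.log m) + (B + m) * Real.log (B + m) ∧
      (2 * (e * Real.log e) + g * Real.log g + k * Real.log k - 2 * (B * Real.log B)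
        - 2 * (m * Real.log m) + (B + m) * Real.log (B + m) ≤ 0 → e * (B + m) = B * m) := by
  rcases (show 0 ≤ B by linarith).eq_or_lt with hB | hB
  · have he0 : e = 0 := by linarith
    have hg0 : g = 0 := by linarith
    have hk0 : k = m := by linarith
    subst he0 hg0 hk0
    rw [← hB]
    simp
    linarith
  · have hT : 0 < B + m := by linarith
    have l1 : Real.log (B * m / (B + m)) = Real.log B + Real.log m - Real.log (B + m) := by
      rw [Real.log_div (mul_pos hB hm).ne' hT.ne', Real.log_mul hB.ne' hm.ne']
    have l2 : Real.log (B * B / (B + m)) = Real.log B + Real.log B - Real.log (B + m) := by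
      rw [Real.log_div (mul_pos hB hB).ne' hT.ne', Real.log_mul hB.ne' hB.ne']
    have l3 : Real.log (m * m / (B + m)) = Real.log m + Real.log m - Real.log (B + m) := by
      rw [Real.log_div (mul_pos hm hm).ne' hT.ne', Real.log_mul hm.ne' hm.ne']
    have p1 : 0 < B * m / (B + m) := by positivity
    have p2 : 0 < B * B / (B + m) := by positivity
    have p3 : 0 < m * m / (B + m) := by positivity
    have k1 := sub_le_mul_log_sub he p1.le fun h => absurd h p1.ne'
    have k2 := sub_le_mul_log_sub hg p2.le fun h => absurd h p2.ne'
    have k3 := sub_le_mul_log_sub hk p3.le fun h => absurd h p3.ne'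
    have hs : 2 * (B * m / (B + m)) + B * B / (B + m) + m * m / (B + m) = B + m := by
      field_simp
      ring
    have hexp : 2 * (e * Real.log e) + g * Real.log g + k * Real.log k - 2 * (B * Real.log B)
        - 2 * (m * Real.log m) + (B + m) * Real.log (B + m)
        = 2 * (e * (Real.log e - Real.log (B * m / (B + m))))
          + g * (Real.log g - Real.log (B * B / (B + m)))
          + k * (Real.log k - Real.log (m * m / (B + m))) := by
      rw [l1, l2, l3, ← h1, ← h2]
      ring
    rw [hexp]
    refine ⟨by linarith, fun hle => ?_⟩
    have := eq_of_mul_log_sub_le he p1.le (fun h => absurd h p1.ne') (by linarith)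
    rw [eq_div_iff hT.ne'] at this
    exact this

/-- The probability that a binomial variable with `d` trials is at least two. -/
noncomputable def tailProb (d : ℕ) (t : ℝ) : ℝ := 1 - (1 - t) ^ d - d * t * (1 - t) ^ (d - 1)

theorem tailProb_pos {d : ℕ} (hd : 2 ≤ d) {t : ℝ} (h0 : 0 < t) (h1 : t < 1) :
    0 < tailProb d t := by
  have := binomial_le_one_lt hd h0 h1
  unfold tailProb
  linarith

section

variable {d : ℕ}

/-- Vertex factors of the comparison measure. -/
noncomputable def vertexWeight (K : Emp d) (θ : ℝ) : Spin → ℝ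
  | one => density K one
  | free => density K free / d
  | zero => density K zero / tailProb d θ

/-- Edge factors of the comparison measure. -/
noncomputable def edgeWeight (K : Emp d) (θ : ℝ) : Msg → ℝ
  | (one, one) => 1
  | (one, η) => varMarginal K (one, η) / density K one
  | (free, one) => θ
  | (free, η) => varMarginal K (free, η) / ((1 - 1 / d) * density K free)
  | (zero, one) => θ
  | (zero, η) => (1 - θ) * varMarginal K (zero, η) / (density K zero - density K one)

/-- The comparison measure. -/
noncomputable def comparison (K : Emp d) (θ : ℝ) (s : Fin d → Msg) : ℝ :=
  psiVar s * (vertexWeight K θ (vertexSpin s) * ∏ i, edgeWeight K θ (s i))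

/-- The value of minus the rate function at the comparison measure. -/
noncomputable def rateBound (d : ℕ) (p₁ β p₀ θ : ℝ) : ℝ :=
  (1 - d) * p₁ * Real.log p₁ + β / 2 * (Real.log β - Real.log d) + p₀ * Real.log p₀
    - p₀ * Real.log (tailProb d θ) + d * (p₀ - p₁) * Real.log (1 - θ) + d * p₁ * Real.log θ
    - d / 2 * (((1 - 1 / d) * β + (p₀ - p₁)) * Real.log ((1 - 1 / d) * β + (p₀ - p₁)))

variable {K : Emp d} (hK : IsBalanced K)

include hK

theorem varMarginal_nonneg (σ : Msg) : 0 ≤ varMarginal K σ := by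
  rw [varMarginal_eq_sum]
  refine mul_nonneg (by positivity) (Finset.sum_nonneg fun s _ => mul_nonneg (hK.2.1 s) ?_)
  exact Finset.sum_nonneg fun i _ => by split_ifs <;> norm_num

theorem density_nonneg (η : Spin) : 0 ≤ density K η := by
  rw [density_eq]
  exact Finset.sum_nonneg fun s _ => mul_nonneg (hK.2.1 s) (by split_ifs <;> norm_num)

theorem density_pos_of_ne {s : Fin d → Msg} (hs : K.1 s ≠ 0) : 0 < density K (vertexSpin s) := by
  rw [density_eq]
  refine Finset.sum_pos' (fun s _ => mul_nonneg (hK.2.1 s) (by split_ifs <;> norm_num))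
    ⟨s, Finset.mem_univ _, ?_⟩
  rw [if_pos rfl, mul_one]
  exact lt_of_le_of_ne (hK.2.1 s) hs.symm

theorem varMarginal_pos_of_ne {s : Fin d → Msg} (hs : K.1 s ≠ 0) (i : Fin d) :
    0 < varMarginal K (s i) := by
  rw [varMarginal_eq_sum]
  have hd : (0 : ℝ) < d := by exact_mod_cast i.pos
  have hc : ∀ s' : Fin d → Msg, ∀ j, (0 : ℝ) ≤ if s' j = s i then 1 else 0 :=
    fun s' j => by split_ifs <;> norm_num
  refine mul_pos (by positivity) (Finset.sum_pos' (fun s' _ => mul_nonneg (hK.2.1 s')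
    (Finset.sum_nonneg fun j _ => hc s' j)) ⟨s, Finset.mem_univ _, ?_⟩)
  refine mul_pos (lt_of_le_of_ne (hK.2.1 s) hs.symm)
    (Finset.sum_pos' (fun j _ => hc s j) ⟨i, Finset.mem_univ _, ?_⟩)
  simp

theorem varMarginal_refl (σ : Msg) : varMarginal K (refl σ) = varMarginal K σ := by
  rw [hK.2.2.2.2.2, hK.2.2.2.2.2, clMarginal_refl hK.1]

/-- Total mass minus the blocks already known, with reflection symmetry for the messages (·, 1). -/
theorem varMarginal_zero (hd : 3 ≤ d) :
    varMarginal K (zero, zero) + varMarginal K (zero, free)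
      = density K zero - density K one := by
  have h1 := varMarginal_one (by omega) hK.1
  have h2 := varMarginal_one_one (by omega) hK.1
  have h3 := varMarginal_free (by omega) hK.1
  have h4 := sum_varMarginal (by omega) K
  have h5 := sum_density K
  rw [msg_sum] at h4
  have e1 : varMarginal K (zero, one) = varMarginal K (one, zero) := varMarginal_refl hK (one, zero)
  have e2 : varMarginal K (free, one) = varMarginal K (one, free) := varMarginal_refl hK (one, free)
  have hd0 : (d : ℝ) ≠ 0 := by exact_mod_cast (by omega : d ≠ 0)
  have h6 : density K free / d = varMarginal K (one, one) := by
    rw [← h2]; field_simp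
  linear_combination h4 - 2 * h1 - h3 - h5 - e1 - e2 + h6

variable (hd : 3 ≤ d) {θ : ℝ} (h0 : 0 < θ) (h1 : θ < 1) (hp : 0 < density K one)
  (hm : 0 < density K zero - density K one)

include hd

theorem freeEdge_eq_zero (h : (1 - 1 / d) * density K free = 0) :
    varMarginal K (free, zero) = 0 ∧ varMarginal K (free, free) = 0 := by
  have h3 := varMarginal_free (by omega) hK.1
  have := varMarginal_nonneg hK (free, zero)
  have := varMarginal_nonneg hK (free, free)
  rw [h] at h3
  constructor <;> linarith

include h0 h1 hp hm

theorem comparison_nonneg (s : Fin d → Msg) : 0 ≤ comparison K θ s := by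
  have hd' : (3 : ℝ) ≤ d := by exact_mod_cast hd
  have hP := tailProb_pos (by omega : 2 ≤ d) h0 h1
  have hκ := varMarginal_nonneg hK
  have hρ := density_nonneg hK
  have h2 : 0 ≤ (1 - 1 / (d : ℝ)) * density K free := by
    refine mul_nonneg ?_ (hρ _)
    rw [sub_nonneg, div_le_one (by linarith)]
    linarith
  refine mul_nonneg (psiVar_nonneg s) (mul_nonneg ?_ (Finset.prod_nonneg fun i _ => ?_))
  · cases vertexSpin s
    · exact div_nonneg (hρ _) hP.le
    · exact hρ _
    · exact div_nonneg (hρ _) (by linarith)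
  · rcases s i with ⟨a | a | a, b | b | b⟩
    · exact div_nonneg (mul_nonneg (by linarith) (hκ _)) hm.le
    · exact h0.le
    · exact div_nonneg (mul_nonneg (by linarith) (hκ _)) hm.le
    · exact div_nonneg (hκ _) hp.le
    · exact zero_le_one
    · exact div_nonneg (hκ _) hp.le
    · exact div_nonneg (hκ _) h2
    · exact h0.le
    · exact div_nonneg (hκ _) h2

theorem weights_ne_zero {s : Fin d → Msg} (hs : K.1 s ≠ 0) :
    vertexWeight K θ (vertexSpin s) ≠ 0 ∧ ∀ i, edgeWeight K θ (s i) ≠ 0 := by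
  have hP := (tailProb_pos (by omega : 2 ≤ d) h0 h1).ne'
  have hd0 : (d : ℝ) ≠ 0 := by exact_mod_cast (by omega : d ≠ 0)
  have hf := freeEdge_eq_zero hK hd
  have h1' : 1 - θ ≠ 0 := by linarith
  have hv : ∀ η, density K η ≠ 0 → vertexWeight K θ η ≠ 0 := by
    rintro (_ | _ | _) h
    · exact div_ne_zero h hP
    · exact h
    · exact div_ne_zero h hd0
  have he : ∀ σ, varMarginal K σ ≠ 0 → edgeWeight K θ σ ≠ 0 := by
    rintro ⟨_ | _ | _, _ | _ | _⟩ hκ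
    · exact div_ne_zero (mul_ne_zero h1' hκ) hm.ne'
    · exact h0.ne'
    · exact div_ne_zero (mul_ne_zero h1' hκ) hm.ne'
    · exact div_ne_zero hκ hp.ne'
    · exact one_ne_zero
    · exact div_ne_zero hκ hp.ne'
    · exact div_ne_zero hκ fun h => hκ (hf h).1
    · exact h0.ne'
    · exact div_ne_zero hκ fun h => hκ (hf h).2
  exact ⟨hv _ (density_pos_of_ne hK hs).ne', fun i => he _ (varMarginal_pos_of_ne hK hs i).ne'⟩

/-- The spin classes have their densities as masses: for 1 and f the edge weights sum to one over
the possible incoming messages, and for 0 the weight `tailProb` of at least two ones is divided out.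
-/
theorem sum_comparison : ∑ s, comparison K θ s = 1 := by
  have hP := (tailProb_pos (by omega : 2 ≤ d) h0 h1).ne'
  have hd0 : (d : ℝ) ≠ 0 := by exact_mod_cast (by omega : d ≠ 0)
  unfold comparison
  rw [sum_psiVar_prod_eq (by omega) _ _ rfl]
  simp only [edgeWeight, vertexWeight, ← add_div, ← mul_add]
  rw [varMarginal_one (by omega) hK.1, varMarginal_free (by omega) hK.1,
    varMarginal_zero hK hd, div_self hp.ne', mul_div_assoc (1 - θ), div_self hm.ne']
  have hf : (d : ℝ) * (density K free / d * (1 * ((1 - 1 / d) * density K free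
      / ((1 - 1 / d) * density K free)) ^ (d - 1))) = density K free := by
    by_cases h : density K free = 0
    · simp [h]
    · have hd1 : (1 : ℝ) - 1 / d ≠ 0 := by
        have hd' : (3 : ℝ) ≤ d := by exact_mod_cast hd
        rw [sub_ne_zero, ne_eq, eq_comm, div_eq_one_iff_eq hd0]
        linarith
      rw [div_self (mul_ne_zero hd1 h)]
      field_simp
      simp
  rw [hf]
  have h2 : θ + (1 - θ) = 1 := by ring
  have h3 : 1 - (1 - θ) ^ d - d * θ * (1 - θ) ^ (d - 1) = tailProb d θ := rfl
  simp only [mul_one, h2, one_pow, h3]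
  have h5 := sum_density K
  rw [hK.2.2.2.1] at h5
  rw [← h5]
  field_simp
  ring

theorem sum_mul_log_comparison :
    ∑ s, K.1 s * Real.log (comparison K θ s)
      = ∑ η, density K η * Real.log (vertexWeight K θ η)
        + d * ∑ σ, varMarginal K σ * Real.log (edgeWeight K θ σ) := by
  have hd0 : (d : ℝ) ≠ 0 := by exact_mod_cast (by omega : d ≠ 0)
  have e1 : ∀ s, K.1 s * Real.log (comparison K θ s)
      = K.1 s * ∑ η, (if vertexSpin s = η then 1 else 0) * Real.log (vertexWeight K θ η)
        + K.1 s * ∑ i, Real.log (edgeWeight K θ (s i)) := by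
    intro s
    by_cases hs : K.1 s = 0
    · simp [hs]
    · obtain ⟨hv, he⟩ := weights_ne_zero hK hd h0 h1 hp hm hs
      have hψ : psiVar s = 1 := psiVar_of_ne fun h => hs (hK.1.1 s h)
      rw [comparison, hψ, one_mul, Real.log_mul hv (Finset.prod_ne_zero_iff.mpr fun i _ => he i),
        Real.log_prod fun i _ => he i]
      simp [mul_add]
  rw [sum_varMarginal_mul, mul_inv_cancel_left₀ hd0]
  simp only [e1, Finset.sum_add_distrib]
  congr 1
  simp only [Finset.mul_sum, density_eq, Finset.sum_mul]
  rw [Finset.sum_comm]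
  simp only [mul_assoc]

/-- Minus the rate function is the bound plus three relative entropies. -/
theorem neg_rate_eq :
    -rate K = rateBound d (density K one) (density K free) (density K zero) θ
      + ∑ s, K.1 s * (Real.log (K.1 s) - Real.log (comparison K θ s))
      + d / 2 * ∑ σ, K.2 (σ, refl σ) * (Real.log (K.2 (σ, refl σ)) - Real.log (varMarginal K σ))
      + d / 2 * (2 * (varMarginal K (free, zero) * Real.log (varMarginal K (free, zero)))
        + varMarginal K (free, free) * Real.log (varMarginal K (free, free))
        + varMarginal K (zero, zero) * Real.log (varMarginal K (zero, zero))
        - 2 * ((1 - 1 / d) * density K free * Real.log ((1 - 1 / d) * density K free))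
        - 2 * ((density K zero - density K one) * Real.log (density K zero - density K one))
        + ((1 - 1 / d) * density K free + (density K zero - density K one))
          * Real.log ((1 - 1 / d) * density K free + (density K zero - density K one))) := by
  have hd0 : (d : ℝ) ≠ 0 := by exact_mod_cast (by omega : d ≠ 0)
  have hP := (tailProb_pos (by omega : 2 ≤ d) h0 h1).ne'
  have hcl : ∑ s, Real.negMulLog (K.2 s) = -∑ σ, K.2 (σ, refl σ) * Real.log (K.2 (σ, refl σ)) := by
    rw [← sum_clause_mul hK.1 fun s => Real.log (K.2 s)]
    simp [Real.negMulLog, Finset.sum_neg_distrib]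
  have hcl2 : ∑ σ, K.2 (σ, refl σ) * Real.log (varMarginal K σ)
      = ∑ σ, varMarginal K σ * Real.log (varMarginal K σ) := by
    have e2 := sum_refl fun σ => K.2 (σ, refl σ) * Real.log (varMarginal K σ)
    simp only [varMarginal_refl hK] at e2
    have e3 : ∀ σ, varMarginal K σ * Real.log (varMarginal K σ)
      = 2⁻¹ * (K.2 (σ, refl σ) * Real.log (varMarginal K σ))
        + 2⁻¹ * (K.2 (refl σ, refl (refl σ)) * Real.log (varMarginal K σ)) := by
      intro σ
      have : refl (refl σ) = σ := rfl
      rw [this]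
      nth_rewrite 1 [hK.2.2.2.2.2, clMarginal_eq hK.1]
      ring
    simp only [e3, Finset.sum_add_distrib, ← Finset.mul_sum, e2]
    ring
  have hlog := sum_mul_log_comparison hK hd h0 h1 hp hm
  have v1 := varMarginal_one (by omega) hK.1
  have v2 := varMarginal_one_one (by omega) hK.1
  have v3 := varMarginal_free (by omega) hK.1
  have v4 := varMarginal_zero hK hd
  have s1 : varMarginal K (zero, one) = varMarginal K (one, zero) := varMarginal_refl hK (one, zero)
  have s2 : varMarginal K (free, one) = varMarginal K (one, free) := varMarginal_refl hK (one, free)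
  have s3 : varMarginal K (zero, free) = varMarginal K (free, zero) :=
    varMarginal_refl hK (free, zero)
  have hf := freeEdge_eq_zero hK hd
  rw [rate_eq hK.1, hcl]
  simp only [mul_sub, Finset.sum_sub_distrib, hlog, hcl2]
  simp only [Real.negMulLog, neg_mul, Finset.sum_neg_distrib]
  have l1 := mul_log_mul_div (c := 1 - θ) (x := varMarginal K (zero, zero))
    (p := density K zero - density K one) (by linarith) (fun h => absurd h hm.ne')
  have l2 := mul_log_mul_div (c := 1 - θ) (x := varMarginal K (free, zero))
    (p := density K zero - density K one) (by linarith) (fun h => absurd h hm.ne')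
  have l3 := mul_log_div (x := varMarginal K (one, zero)) (fun h => absurd h hp.ne')
  have l4 := mul_log_div (x := varMarginal K (one, free)) (fun h => absurd h hp.ne')
  have l5 := mul_log_div (fun h => (hf h).1)
  have l6 := mul_log_div (fun h => (hf h).2)
  have l7 := mul_log_div (x := density K zero) (fun h => absurd h hP)
  have l8 := mul_log_div (x := density K free) (fun h => absurd h hd0)
  have v5 : varMarginal K (one, one) = density K free / d := by
    rw [← v2]; field_simp
  have l10 : density K free / d * Real.log (density K free / d)
      = density K free / d * (Real.log (density K free) - Real.log d) := by
    rw [div_mul_eq_mul_div, l8]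
    ring
  have hcc : d * (density K free / d) = density K free := by field_simp
  rw [s3] at v4
  simp only [spin_sum, msg_sum, vertexWeight, edgeWeight, s1, s2, s3, v5]
  rw [l1, l2, l3, l4, l5, l6, l7, l8, l10, Real.log_one]
  unfold rateBound
  -- The marginals at (1,0) and (1,f) enter the θ-terms only through their sum, the density of ones;
  -- hence the bound depends on K through its densities alone.
  linear_combination d * (Real.log θ - Real.log (density K one)) * v1
    + d * (Real.log (1 - θ) - Real.log (density K zero - density K one)) * v4
    - d * Real.log ((1 - 1 / d) * density K free) * v3
    - 1 / 2 * (Real.log (density K free) - Real.log d) * hcc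

/-- Upper bound for the rate function, with the equality cases. -/
theorem rate_le :
    rate K ≤ -rateBound d (density K one) (density K free) (density K zero) θ ∧
    (-rateBound d (density K one) (density K free) (density K zero) θ ≤ rate K →
      (∀ s, K.1 s = comparison K θ s) ∧ (∀ σ, K.2 (σ, refl σ) = varMarginal K σ) ∧
      varMarginal K (free, zero) * ((1 - 1 / d) * density K free
          + (density K zero - density K one))
        = (1 - 1 / d) * density K free * (density K zero - density K one)) := by
  have hd' : (3 : ℝ) ≤ d := by exact_mod_cast hd
  have hκ := varMarginal_nonneg hK
  have key := neg_rate_eq hK hd h0 h1 hp hm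
  have g1 := gibbs hK.2.1 (comparison_nonneg hK hd h0 h1 hp hm)
    (fun s hs => by
      by_contra hne
      obtain ⟨hv, he⟩ := weights_ne_zero hK hd h0 h1 hp hm hne
      rw [comparison, psiVar_of_ne fun h => hne (hK.1.1 s h)] at hs
      exact mul_ne_zero one_ne_zero
        (mul_ne_zero hv (Finset.prod_ne_zero_iff.mpr fun i _ => he i)) hs)
    (by rw [hK.2.2.2.1, sum_comparison hK hd h0 h1 hp hm])
  have hcl := clMarginal_eq hK.1
  have g2 := gibbs (x := fun σ => K.2 (σ, refl σ)) (w := varMarginal K)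
    (fun σ => hK.2.2.1 _) hκ
    (fun σ hσ => by
      rw [hK.2.2.2.2.2, hcl] at hσ
      have a1 := hK.2.2.1 (σ, refl σ)
      have a2 := hK.2.2.1 (refl σ, σ)
      linarith)
    (by
      rw [sum_varMarginal (by omega), hK.2.2.2.1, ← hK.2.2.2.2.1]
      have := sum_clause_mul hK.1 fun _ => 1
      simp only [mul_one] at this
      exact this.symm)
  have s3 : varMarginal K (zero, free) = varMarginal K (free, zero) :=
    varMarginal_refl hK (free, zero)
  have v4 := varMarginal_zero hK hd
  rw [s3, add_comm] at v4
  have g3 := two_by_two_entropy (hκ _) (hκ _) (hκ _) (varMarginal_free (by omega) hK.1) v4 hm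
  have hhalf : (0 : ℝ) < d / 2 := by linarith
  have m2 := mul_nonneg hhalf.le g2.1
  have m3 := mul_nonneg hhalf.le g3.1
  refine ⟨by linarith, fun hle => ?_⟩
  have n1 := g1.2 (by linarith [g1.1])
  have n2 := g2.2 (nonpos_of_mul_nonpos_right (by linarith [g1.1]) hhalf)
  have n3 := g3.2 (nonpos_of_mul_nonpos_right (by linarith [g1.1]) hhalf)
  exact ⟨n1, n2, n3⟩

end

end FrozenModel

/-! ### Quadratic growth of the bound along fixed intensity. -/

namespace FrozenModel

open Spin

/-- Applying log t ≤ t − 1 to t = √(y/x) gives x log(x/y) ≥ (x − y) + (√x − √y)². The square is at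
least (x − y)²/(4M) because (√x + √y)² ≤ 4M. -/
theorem add_sq_le_mul_log_sub {x y M : ℝ} (hx : 0 ≤ x) (hy : 0 < y) (hxM : x ≤ M) (hyM : y ≤ M) :
    x - y + (x - y) ^ 2 / (4 * M) ≤ x * (Real.log x - Real.log y) := by
  have hM : 0 < M := hy.trans_le hyM
  have h1 : 2 * x - 2 * (√x * √y) ≤ x * (Real.log x - Real.log y) := by
    rcases hx.eq_or_lt with rfl | hx
    · simp
    · have hsx := Real.sqrt_pos.mpr hx
      have hsy := Real.sqrt_pos.mpr hy
      have := Real.log_le_sub_one_of_pos (div_pos hsy hsx)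
      rw [Real.log_div hsy.ne' hsx.ne', Real.log_sqrt hx.le, Real.log_sqrt hy.le] at this
      have h2 := mul_le_mul_of_nonneg_left this hx.le
      have h3 : x * (√y / √x) = √x * √y := by
        field_simp
        rw [Real.sq_sqrt hx.le]
      linarith
  have h2 : (x - y) ^ 2 / (4 * M) ≤ (√x - √y) ^ 2 := by
    rw [div_le_iff₀ (by linarith)]
    have e : x - y = (√x - √y) * (√x + √y) := by
      ring_nf
      rw [Real.sq_sqrt hx, Real.sq_sqrt hy.le]
    rw [e, mul_pow]
    refine mul_le_mul_of_nonneg_left ?_ (sq_nonneg _)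
    have := sq_nonneg (√x - √y)
    have a1 := Real.sq_sqrt hx
    have a2 := Real.sq_sqrt hy.le
    nlinarith
  have a1 := Real.sq_sqrt hx
  have a2 := Real.sq_sqrt hy.le
  nlinarith

theorem mul_log_sub_le {T ε : ℝ} (hT : 1 / 2 ≤ T) (hTε : 1 / 2 ≤ T + ε) :
    (T + ε) * (Real.log (T + ε) - Real.log T) ≤ ε + 2 * ε ^ 2 := by
  have hT0 : T ≠ 0 := by linarith
  have hl := Real.log_le_sub_one_of_pos (div_pos (by linarith : 0 < T + ε) (by linarith : 0 < T))
  rw [Real.log_div (by linarith) hT0] at hl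
  have h2 : (T + ε) * ((T + ε) / T - 1) = ε + ε ^ 2 / T := by
    field_simp
    ring
  have h3 := mul_le_mul_of_nonneg_left hl (by linarith : 0 ≤ T + ε)
  have h4 : ε ^ 2 / T ≤ 2 * ε ^ 2 := by
    rw [div_le_iff₀ (by linarith)]
    nlinarith [sq_nonneg ε]
  linarith

theorem sub_le_log_sub {x ω : ℝ} (hx : 1 / 2 ≤ x) (hxω : 1 / 2 ≤ x + ω) :
    ω / x - 4 * ω ^ 2 ≤ Real.log (x + ω) - Real.log x := by
  have e1 : x ≠ 0 := by linarith
  have e2 : x + ω ≠ 0 := by linarith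
  have hl := Real.log_le_sub_one_of_pos (div_pos (by linarith : 0 < x) (by linarith : 0 < x + ω))
  rw [Real.log_div e1 e2] at hl
  have h2 : x / (x + ω) - 1 = -(ω / x) + ω ^ 2 / (x * (x + ω)) := by
    field_simp
    ring
  have h3 : ω ^ 2 / (x * (x + ω)) ≤ 4 * ω ^ 2 := by
    have e3 : 1 / 4 ≤ x * (x + ω) := by nlinarith
    rw [div_le_iff₀ (by linarith)]
    nlinarith [sq_nonneg ω]
  linarith

/-- The maximum of t(1 − t)^n lies at 1/(n + 1). Monotonicity beyond it is Bernoulli's inequality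
for ((1 − s)/(1 − t))^n. -/
theorem mul_one_sub_pow_antitone {n : ℕ} {s t : ℝ} (hs : 1 ≤ (n + 1) * s) (hst : s ≤ t)
    (ht : t < 1) : t * (1 - t) ^ n ≤ s * (1 - s) ^ n := by
  have hs0 : 0 < s := by
    by_contra! h
    have : (n + 1) * s ≤ 0 := mul_nonpos_of_nonneg_of_nonpos (by positivity) h
    linarith
  have h1t : 0 < 1 - t := by linarith
  have hb := one_add_mul_le_pow (show (-2 : ℝ) ≤ (t - s) / (1 - t) from
    le_trans (by norm_num) (div_nonneg (by linarith) h1t.le)) n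
  have e : 1 + (t - s) / (1 - t) = (1 - s) / (1 - t) := by field_simp; ring
  rw [e, div_pow, le_div_iff₀ (by positivity)] at hb
  have h2 : t ≤ s * (1 + n * ((t - s) / (1 - t))) := by
    have h3 : (t - s) * (1 - t) ≤ (t - s) * (n * s) :=
      mul_le_mul_of_nonneg_left (by linarith) (by linarith)
    have h4 : t - s ≤ (t - s) * (n * s) / (1 - t) := by
      rw [le_div_iff₀ h1t]; exact h3
    calc t ≤ s + (t - s) * (n * s) / (1 - t) := by linarith
      _ = _ := by ring
  calc t * (1 - t) ^ n ≤ s * (1 + n * ((t - s) / (1 - t))) * (1 - t) ^ n :=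
        mul_le_mul_of_nonneg_right h2 (by positivity)
    _ = s * ((1 + n * ((t - s) / (1 - t))) * (1 - t) ^ n) := by ring
    _ ≤ _ := mul_le_mul_of_nonneg_left hb hs0.le

theorem hasDerivAt_tailProb {d : ℕ} (hd : 2 ≤ d) (t : ℝ) :
    HasDerivAt (tailProb d) (d * (d - 1) * (t * (1 - t) ^ (d - 2))) t := by
  obtain ⟨n, rfl⟩ : ∃ n, d = n + 2 := ⟨d - 2, by omega⟩
  have h1 : HasDerivAt (fun t : ℝ => 1 - t) (-1) t := by
    simpa using (hasDerivAt_id t).const_sub 1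
  have h2 := (h1.fun_pow (n + 2)).const_sub 1
  have h3 := ((hasDerivAt_id t).const_mul ((n + 2 : ℕ) : ℝ)).fun_mul (h1.fun_pow (n + 1))
  refine (h2.fun_sub h3).congr_deriv ?_
  simp only [id, Nat.add_sub_cancel, show n + 2 - 1 = n + 1 from rfl]
  push_cast
  ring

/-- The derivative of `tailProb` decreases beyond 1/(d − 1), so the function is concave there and
lies below its tangents. -/
theorem tailProb_le_tangent {d : ℕ} (hd : 2 ≤ d) {s t : ℝ} (hs : 1 ≤ (d - 1) * s)
    (ht : 1 ≤ (d - 1) * t) (hs1 : s < 1) (ht1 : t < 1) :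
    tailProb d t ≤ tailProb d s + d * (d - 1) * (s * (1 - s) ^ (d - 2)) * (t - s) := by
  have hc : Continuous (tailProb d) := by unfold tailProb; fun_prop
  have hd' : (2 : ℝ) ≤ d := by exact_mod_cast hd
  have hdd : (0 : ℝ) ≤ d * (d - 1) := mul_nonneg (by linarith) (by linarith)
  have hcast : ((d - 2 : ℕ) : ℝ) + 1 = d - 1 := by
    rw [Nat.cast_sub hd]; push_cast; ring
  rcases lt_trichotomy s t with h | h | h
  · obtain ⟨c, hc1, hc2⟩ := exists_hasDerivAt_eq_slope (tailProb d) _ h hc.continuousOn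
      fun x _ => hasDerivAt_tailProb hd x
    rw [eq_div_iff (by linarith)] at hc2
    have := mul_le_mul_of_nonneg_left (mul_one_sub_pow_antitone (n := d - 2)
      (by rw [hcast]; exact hs) hc1.1.le (hc1.2.trans ht1)) hdd
    nlinarith
  · subst h; simp
  · obtain ⟨c, hc1, hc2⟩ := exists_hasDerivAt_eq_slope (tailProb d) _ h hc.continuousOn
      fun x _ => hasDerivAt_tailProb hd x
    rw [eq_div_iff (by linarith)] at hc2
    have := mul_le_mul_of_nonneg_left (mul_one_sub_pow_antitone (n := d - 2)
      (by
        rw [hcast]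
        exact ht.trans (mul_le_mul_of_nonneg_left hc1.1.le (by linarith)))
      hc1.2.le hs1) hdd
    nlinarith

section

variable {d : ℕ} {q y Z p₁ β p₀ : ℝ} (hd : 3 ≤ d) (hq0 : 0 < q) (hq1 : q < 1)
  (hy : y = (1 - q) ^ (d - 1)) (hZ : Z = 1 + q - y) (hp₁ : p₁ = q * (1 - y) / Z)
  (hβ : β = d * q * y / Z) (hp₀ : p₀ = tailProb d q / Z)

include hd hq0 hq1 hy hZ hp₁ hβ hp₀

theorem star_total : Z ≠ 0 ∧ 0 < Z ∧ 0 < y ∧ y < 1 ∧ tailProb d q = 1 - (1 - q) * y - d * q * y ∧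
    (1 - 1 / d) * β + (p₀ - p₁) = (1 - q) * (1 - y) / Z ∧ p₀ + p₁ + β = 1 := by
  have hy0 : 0 < y := by rw [hy]; exact pow_pos (by linarith) _
  have hy1 : y < 1 := by
    rw [hy]; exact pow_lt_one₀ (by linarith) (by linarith) (by omega)
  have hd0 : (d : ℝ) ≠ 0 := by exact_mod_cast (by omega : d ≠ 0)
  have hZ0 : 0 < Z := by rw [hZ]; linarith
  have hP : tailProb d q = 1 - (1 - q) * y - d * q * y := by
    rw [tailProb, hy, ← pow_succ']
    congr 4
    omega
  refine ⟨hZ0.ne', hZ0, hy0, hy1, hP, ?_, ?_⟩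
  · rw [hp₁, hβ, hp₀, hP]
    field_simp
    ring
  · rw [hp₁, hβ, hp₀, hP, ← add_div, ← add_div, div_eq_one_iff_eq hZ0.ne', hZ]
    ring

theorem star_logs : Real.log p₁ = Real.log q + Real.log (1 - y) - Real.log Z ∧
    Real.log β = Real.log d + Real.log q + Real.log y - Real.log Z ∧
    Real.log p₀ = Real.log (tailProb d q) - Real.log Z ∧
    Real.log ((1 - 1 / d) * β + (p₀ - p₁))
      = Real.log (1 - q) + Real.log (1 - y) - Real.log Z ∧
    Real.log y = (d - 1) * Real.log (1 - q) := by
  obtain ⟨hZ0, -, hy0, hy1, -, hT, -⟩ := star_total hd hq0 hq1 hy hZ hp₁ hβ hp₀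
  have hd0 : (d : ℝ) ≠ 0 := by exact_mod_cast (by omega : d ≠ 0)
  have hP := (tailProb_pos (by omega : 2 ≤ d) hq0 hq1).ne'
  have h1y : 1 - y ≠ 0 := by linarith
  have h1q : 1 - q ≠ 0 := by linarith
  refine ⟨?_, ?_, ?_, ?_, ?_⟩
  · rw [hp₁, Real.log_div (mul_ne_zero hq0.ne' h1y) hZ0, Real.log_mul hq0.ne' h1y]
  · rw [hβ, Real.log_div (mul_ne_zero (mul_ne_zero hd0 hq0.ne') hy0.ne') hZ0,
      Real.log_mul (mul_ne_zero hd0 hq0.ne') hy0.ne', Real.log_mul hd0 hq0.ne']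
  · rw [hp₀, Real.log_div hP hZ0]
  · rw [hT, Real.log_div (mul_ne_zero h1q h1y) hZ0, Real.log_mul h1q h1y]
  · rw [hy, Real.log_pow, Nat.cast_pred (by omega)]

theorem rateBound_star : rateBound d p₁ β p₀ q
    = (p₁ + 1 / 2 * β) * (Real.log q + Real.log (1 - y) - Real.log (1 - q) - Real.log y)
      - Real.log Z + d / 2 * (Real.log (1 - q) + Real.log Z - Real.log (1 - y)) := by
  obtain ⟨-, -, -, -, -, -, hs⟩ := star_total hd hq0 hq1 hy hZ hp₁ hβ hp₀
  obtain ⟨l1, l2, l3, l4, l5⟩ := star_logs hd hq0 hq1 hy hZ hp₁ hβ hp₀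
  have hd0 : (d : ℝ) * (d : ℝ)⁻¹ = 1 := mul_inv_cancel₀ (by exact_mod_cast (by omega : d ≠ 0))
  have hp : p₀ = 1 - p₁ - β := by linarith
  rw [rateBound, l1, l2, l3, l4, l5, hp]
  simp only [one_div]
  generalize (d : ℝ)⁻¹ = i at *
  linear_combination (β / 2 * (Real.log (1 - q) + Real.log (1 - y) - Real.log Z)) * hd0

/-- The term (1 − d) p log p has the wrong sign of convexity. Moving θ proportionally to the density
of ones makes d p log θ absorb it, leaving a single convex p log p. All terms are then estimated to
second order, and the linear parts cancel. -/
theorem rateBound_ge {δ M θ : ℝ} (hθ2 : θ ≤ 1 / 2) (hqd : 1 ≤ (d - 1) * q)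
    (hθd : 1 ≤ (d - 1) * θ) (hp : 0 < p₁ - δ / 2) (hθ : θ = q * (p₁ - δ / 2) / p₁)
    (hqp : q ≤ 2 * p₁) (hm : 1 / 2 ≤ p₀ - p₁) (hP : 1 / 2 ≤ tailProb d q)
    (hβ0 : 0 ≤ β + δ) (hβM : β ≤ M) (hβM' : β + δ ≤ M) :
    rateBound d p₁ β p₀ q + δ ^ 2 * (1 / (8 * M) - 6 * d)
      ≤ rateBound d (p₁ - δ / 2) (β + δ) (p₀ - δ / 2) θ := by
  obtain ⟨hZ0, hZpos, hy0, hy1, hPe, hT, hs⟩ := star_total hd hq0 hq1 hy hZ hp₁ hβ hp₀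
  obtain ⟨l1, l2, l3, l4, l5⟩ := star_logs hd hq0 hq1 hy hZ hp₁ hβ hp₀
  have hd' : (3 : ℝ) ≤ d := by exact_mod_cast hd
  have hd0 : (d : ℝ) ≠ 0 := by linarith
  have hi : 0 ≤ 1 - 1 / (d : ℝ) ∧ 1 - 1 / (d : ℝ) ≤ 1 := by
    have : 0 < 1 / (d : ℝ) := by positivity
    have : 1 / (d : ℝ) ≤ 1 := by rw [div_le_one (by linarith)]; linarith
    constructor <;> linarith
  have hp1 : 0 < p₁ := by rw [hp₁]; exact div_pos (mul_pos hq0 (by linarith)) hZpos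
  have hβp : 0 < β := by rw [hβ]; positivity
  have hθ0 : 0 < θ := by rw [hθ]; positivity
  have hTs : 1 / 2 ≤ (1 - 1 / d) * β + (p₀ - p₁) := by
    have := mul_nonneg hi.1 hβp.le
    linarith
  have hTn : 1 / 2 ≤ (1 - 1 / d) * (β + δ) + (p₀ - p₁) := by
    have := mul_nonneg hi.1 hβ0
    linarith
  have hPθ := tailProb_pos (by omega : 2 ≤ d) hθ0 (by linarith)
  have hPq : 0 < tailProb d q := by linarith
  have A1 := sub_le_mul_log_sub hp.le hp1.le fun h => absurd h hp1.ne'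
  have A2 := add_sq_le_mul_log_sub hβ0 hβp hβM' hβM
  have A3 := sub_le_mul_log_sub (x := p₀ - δ / 2) (w := p₀) (by linarith) (by linarith)
    fun h => by linarith
  have A4 : ((1 - 1 / d) * (β + δ) + (p₀ - p₁)) *
      (Real.log ((1 - 1 / d) * (β + δ) + (p₀ - p₁)) - Real.log ((1 - 1 / d) * β + (p₀ - p₁)))
      ≤ (1 - 1 / d) * δ + 2 * δ ^ 2 := by
    have e : (1 - 1 / (d : ℝ)) * (β + δ) + (p₀ - p₁)
        = ((1 - 1 / d) * β + (p₀ - p₁)) + (1 - 1 / d) * δ := by ring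
    have hε2 : ((1 - 1 / (d : ℝ)) * δ) ^ 2 ≤ δ ^ 2 := by
      rw [mul_pow]
      exact mul_le_of_le_one_left (sq_nonneg _) (pow_le_one₀ hi.1 hi.2)
    rw [e] at hTn ⊢
    exact (mul_log_sub_le hTs hTn).trans (by linarith)
  obtain ⟨ω, hω⟩ : ∃ ω, ω = q - θ := ⟨_, rfl⟩
  -- The parameter θ moves by cδ with c ≤ 1, so its square is controlled by δ².
  obtain ⟨c, hc⟩ : ∃ c, c = q / (2 * p₁) := ⟨_, rfl⟩
  have hc0 : 0 < c := by rw [hc]; positivity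
  have hc1 : c ≤ 1 := by rw [hc, div_le_one (by positivity)]; exact hqp
  have hωc : ω = c * δ := by rw [hω, hθ, hc]; field_simp; ring
  have hω2 : ω ^ 2 ≤ δ ^ 2 := by
    rw [hωc, mul_pow]
    exact mul_le_of_le_one_left (sq_nonneg _) (pow_le_one₀ hc0.le hc1)
  have hθω : 1 - θ = 1 - q + ω := by rw [hω]; ring
  have A5 : ω / (1 - q) - 4 * ω ^ 2 ≤ Real.log (1 - θ) - Real.log (1 - q) := by
    rw [hθω]
    exact sub_le_log_sub (by linarith) (by linarith)
  obtain ⟨P', hP'⟩ : ∃ P', P' = d * (d - 1) * (q * (1 - q) ^ (d - 2)) := ⟨_, rfl⟩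
  have hP'0 : 0 ≤ P' := by
    rw [hP']
    exact mul_nonneg (mul_nonneg (by linarith) (by linarith))
      (mul_nonneg hq0.le (pow_nonneg (by linarith) _))
  have hP'd : P' ≤ d := by
    have := binomial_le_one_lt (N := d - 1) (by omega) hq0 hq1
    rw [Nat.cast_pred (by omega : 0 < d), show d - 1 - 1 = d - 2 by omega, ← hy] at this
    have h2 : ((d : ℝ) - 1) * q * (1 - q) ^ (d - 2) ≤ 1 := by linarith
    calc P' = d * (((d : ℝ) - 1) * q * (1 - q) ^ (d - 2)) := by rw [hP']; ring
      _ ≤ d * 1 := mul_le_mul_of_nonneg_left h2 (by linarith)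
      _ = d := mul_one _
  have A6 : Real.log (tailProb d θ) - Real.log (tailProb d q) ≤ -(P' * ω / tailProb d q) := by
    have htan := tailProb_le_tangent (by omega : 2 ≤ d) hqd hθd hq1 (by linarith)
    rw [← hP'] at htan
    have hl := Real.log_le_sub_one_of_pos (div_pos hPθ hPq)
    rw [Real.log_div hPθ.ne' hPq.ne'] at hl
    have h2 : tailProb d θ / tailProb d q - 1 ≤ -(P' * ω / tailProb d q) := by
      rw [div_sub_one hPq.ne', ← neg_div]
      refine div_le_div_of_nonneg_right ?_ hPq.le
      rw [hω]
      linarith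
    linarith
  -- First-order optimality of θ = q for the unperturbed bound, multiplied by the displacement ω;
  -- here P' is the derivative of `tailProb` at q.
  have hlin : d * (p₀ - p₁) * (ω / (1 - q)) + p₀ * (P' * ω / tailProb d q) = d * δ / 2 := by
    have hyx : (1 - q) ^ (d - 2) = y / (1 - q) := by
      rw [eq_div_iff (by linarith), hy, ← pow_succ]
      congr 1
      omega
    have h1y : 1 - y ≠ 0 := by linarith
    have h1q : 1 - q ≠ 0 := by linarith
    have hcy : c = Z / (2 * (1 - y)) := by
      rw [hc, hp₁]
      field_simp
    have hp0P : p₀ * (P' * ω / tailProb d q) = P' * ω / Z := by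
      rw [hp₀]
      field_simp
    rw [hp0P, hωc, hcy, hp₀, hp₁, hP', hyx, hPe]
    field_simp
    ring
  have hlogθ : Real.log θ = Real.log q + Real.log (p₁ - δ / 2) - Real.log p₁ := by
    rw [hθ, Real.log_div (mul_ne_zero hq0.ne' hp.ne') hp1.ne', Real.log_mul hq0.ne' hp.ne']
  -- The logarithmic coefficient of δ/2 vanishes: stationarity of the densities in the direction
  -- that preserves the intensity.
  have hres : (d - 1) * Real.log p₁ + Real.log β - Real.log d - Real.log p₀
      + Real.log (tailProb d q) - d * Real.log q
      - (d - 1) * Real.log ((1 - 1 / d) * β + (p₀ - p₁)) = 0 := by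
    rw [l1, l2, l3, l4, l5]
    ring
  have B5 := mul_le_mul_of_nonneg_left A5
    (mul_nonneg (by linarith) (by linarith) : 0 ≤ (d : ℝ) * (p₀ - p₁))
  have hp0' : 0 ≤ p₀ - δ / 2 := by linarith
  have B6 := mul_le_mul_of_nonneg_left A6 hp0'
  have B4 := mul_le_mul_of_nonneg_left A4 (by linarith : 0 ≤ (d : ℝ) / 2)
  have hid : rateBound d (p₁ - δ / 2) (β + δ) (p₀ - δ / 2) θ - rateBound d p₁ β p₀ q
      = (p₁ - δ / 2) * (Real.log (p₁ - δ / 2) - Real.log p₁)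
        + 1 / 2 * ((β + δ) * (Real.log (β + δ) - Real.log β))
        + (p₀ - δ / 2) * (Real.log (p₀ - δ / 2) - Real.log p₀)
        - d / 2 * (((1 - 1 / d) * (β + δ) + (p₀ - p₁)) *
          (Real.log ((1 - 1 / d) * (β + δ) + (p₀ - p₁))
            - Real.log ((1 - 1 / d) * β + (p₀ - p₁))))
        + d * (p₀ - p₁) * (Real.log (1 - θ) - Real.log (1 - q))
        - (p₀ - δ / 2) * (Real.log (tailProb d θ) - Real.log (tailProb d q)) := by
    have e0 : p₀ - δ / 2 - (p₁ - δ / 2) = p₀ - p₁ := by ring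
    have hdi : (d : ℝ) * (1 / d) = 1 := by field_simp
    rw [rateBound, rateBound, e0, hlogθ]
    generalize Real.log ((1 - 1 / d) * (β + δ) + (p₀ - p₁)) = a1 at *
    generalize Real.log ((1 - 1 / d) * β + (p₀ - p₁)) = a2 at *
    generalize 1 / (d : ℝ) = i at *
    linear_combination δ / 2 * hres + δ / 2 * a2 * hdi
  have hM : δ ^ 2 * (1 / (8 * M)) = 1 / 2 * (δ ^ 2 / (4 * M)) := by
    have : M ≠ 0 := by linarith
    field_simp
    ring
  have F1 : d * (p₀ - p₁) * (4 * ω ^ 2) ≤ 4 * d * δ ^ 2 := by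
    have h1 : p₀ - p₁ ≤ 1 := by linarith
    have h2 : (p₀ - p₁) * ω ^ 2 ≤ 1 * δ ^ 2 :=
      mul_le_mul h1 hω2 (sq_nonneg _) zero_le_one
    calc d * (p₀ - p₁) * (4 * ω ^ 2) = 4 * d * ((p₀ - p₁) * ω ^ 2) := by ring
      _ ≤ 4 * d * (1 * δ ^ 2) := mul_le_mul_of_nonneg_left h2 (by linarith)
      _ = _ := by ring
  have F2 : δ / 2 * (P' * ω / tailProb d q) ≤ d * δ ^ 2 := by
    have e : δ / 2 * (P' * ω / tailProb d q) = δ ^ 2 * (P' * c / (2 * tailProb d q)) := by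
      rw [hωc]
      field_simp
    have h2 : P' * c / (2 * tailProb d q) ≤ d := by
      rw [div_le_iff₀ (by linarith)]
      exact (mul_le_mul hP'd hc1 hc0.le (by linarith)).trans
        (mul_le_mul_of_nonneg_left (by linarith) (by linarith))
    rw [e, mul_comm (d : ℝ)]
    exact mul_le_mul_of_nonneg_left h2 (sq_nonneg _)
  have hdi : (d : ℝ) / 2 * ((1 - 1 / d) * δ + 2 * δ ^ 2) = d * δ / 2 - δ / 2 + d * δ ^ 2 := by
    field_simp
  rw [hdi] at B4
  rw [add_sub_cancel_left] at A2
  rw [mul_sub] at B5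
  -- The loss 6dδ² is dδ² from `B4`, 4dδ² from `F1` and dδ² from `F2`; the gain is half the
  -- quadratic term of `A2`.
  linarith [hid, A1, A2, A3, B4, B5, B6, F1, F2, hlin, hM]

end

end FrozenModel

/-! ### Equality in the entropy bound, and the densities of the symmetric point. -/

namespace FrozenModel

open Spin

theorem out_ne_one_of_zero {d : ℕ} {s : Fin d → Msg} (hs : psiVar s ≠ 0)
    (hv : vertexSpin s = zero) (i : Fin d) : (s i).1 ≠ one := by
  rw [vertexSpin_eq] at hv
  have h0 : (ones fun j => (s j).2).card ≠ 0 := fun h => by rw [h] at hv; exact absurd hv (by decide)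
  have h1 : (ones fun j => (s j).2).card ≠ 1 := fun h => by rw [h] at hv; exact absurd hv (by decide)
  rcases card_ones_cases hs i with ⟨-, h, -, -⟩ | ⟨-, h, -⟩ <;>
  · rw [h, ne_eq, rule_eq_one_iff]
    omega

theorem vertexSpin_of_free_one {d : ℕ} {s : Fin d → Msg} (hs : psiVar s ≠ 0) {i : Fin d}
    (hi : s i = (free, one)) : vertexSpin s = zero := by
  rw [vertexSpin_eq]
  rcases card_ones_cases hs i with ⟨-, h, hc, -⟩ | ⟨h, -, -⟩
  · rw [hi, eq_comm, rule_eq_free_iff] at h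
    exact rule_of_two_le (by omega)
  · exact absurd (by rw [hi]) h

/-- The data fix every weight except the split of the edges sending 1 between incoming 0 and f.
Spin-0 vertices never send 1, so the measures agree on them. They alone produce (f,1) edges, and
reflecting that marginal to (1,f) fixes the split. -/
theorem eq_of_eq_comparison {d : ℕ} (hd : 3 ≤ d) {K H : Emp d} (hK : IsBalanced K)
    (hH : IsBalanced H) {θ : ℝ} (h1 : density K one = density H one)
    (h2 : density K free = density H free) (hK1 : ∀ s, K.1 s = comparison K θ s)
    (hH1 : ∀ s, H.1 s = comparison H θ s)
    (hK2 : ∀ σ, K.2 (σ, refl σ) = varMarginal K σ)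
    (hH2 : ∀ σ, H.2 (σ, refl σ) = varMarginal H σ)
    (hf : varMarginal K (free, zero) = varMarginal H (free, zero)) : K = H := by
  have h0 : density K zero = density H zero := by
    have a := sum_density K
    have b := sum_density H
    rw [hK.2.2.2.1] at a
    rw [hH.2.2.2.1] at b
    linarith
  have hff : varMarginal K (free, free) = varMarginal H (free, free) := by
    have a := varMarginal_free (by omega) hK.1
    have b := varMarginal_free (by omega) hH.1
    rw [h2] at a
    linarith
  have h0f : varMarginal K (zero, free) = varMarginal H (zero, free) := by
    have a : varMarginal K (zero, free) = varMarginal K (free, zero) :=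
      varMarginal_refl hK (free, zero)
    have b : varMarginal H (zero, free) = varMarginal H (free, zero) :=
      varMarginal_refl hH (free, zero)
    rw [a, b, hf]
  have h00 : varMarginal K (zero, zero) = varMarginal H (zero, zero) := by
    have a := varMarginal_zero hK hd
    have b := varMarginal_zero hH hd
    rw [h0, h1] at a
    linarith
  have hv : vertexWeight K θ = vertexWeight H θ := by
    funext η
    cases η <;> simp only [vertexWeight, h0, h1, h2]
  have he : ∀ σ : Msg, σ.1 ≠ one → edgeWeight K θ σ = edgeWeight H θ σ := by
    rintro ⟨_ | _ | _, _ | _ | _⟩ hσ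
    all_goals first
      | exact absurd rfl hσ
      | simp only [edgeWeight, h0, h1, h2, hf, hff, h0f, h00]
  have hz : ∀ s, psiVar s ≠ 0 → vertexSpin s = zero → K.1 s = H.1 s := by
    intro s hs hz
    rw [hK1, hH1, comparison, comparison, hv,
      Finset.prod_congr rfl fun i _ => he _ (out_ne_one_of_zero hs hz i)]
  have hf1 : varMarginal K (free, one) = varMarginal H (free, one) := by
    rw [varMarginal_eq_sum, varMarginal_eq_sum]
    congr 1
    refine Finset.sum_congr rfl fun s _ => ?_
    by_cases hs : psiVar s = 0
    · rw [hK.1.1 s hs, hH.1.1 s hs]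
    · by_cases hz' : vertexSpin s = zero
      · rw [hz s hs hz']
      · have : ∀ i, ¬ s i = (free, one) := fun i hi => hz' (vertexSpin_of_free_one hs hi)
        simp [this]
  have h1f : varMarginal K (one, free) = varMarginal H (one, free) := by
    have a : varMarginal K (free, one) = varMarginal K (one, free) :=
      varMarginal_refl hK (one, free)
    have b : varMarginal H (free, one) = varMarginal H (one, free) :=
      varMarginal_refl hH (one, free)
    rw [← a, ← b, hf1]
  have h10 : varMarginal K (one, zero) = varMarginal H (one, zero) := by
    have a := varMarginal_one (by omega) hK.1
    have b := varMarginal_one (by omega) hH.1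
    rw [h1] at a
    linarith
  have he' : edgeWeight K θ = edgeWeight H θ := by
    funext σ
    by_cases hσ : σ.1 = one
    · obtain ⟨a, b⟩ := σ
      simp only at hσ
      subst hσ
      cases b <;> simp only [edgeWeight, h1, h1f, h10]
    · exact he σ hσ
  have hfst : K.1 = H.1 := by
    funext s
    rw [hK1, hH1, comparison, comparison, hv, he']
  refine Prod.ext hfst (funext fun s => ?_)
  obtain ⟨σ, τ⟩ := s
  by_cases h : τ = refl σ
  · rw [h, hK2, hH2, varMarginal_eq_sum, varMarginal_eq_sum, hfst]
  · have hψ : psiCl (σ, τ) = 0 := by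
      have : ¬ σ = refl τ := fun h' => h (by rw [h']; rfl)
      simp [psiCl, this]
    rw [hK.1.2 _ hψ, hH.1.2 _ hψ]

section

variable {d : ℕ} {lam : ℝ} {q : Spin → ℝ} (hq : IsFrozenFixedPoint d lam q) (hd : 3 ≤ d)
  (hlam : 1 < lam)

include hq hd hlam

theorem edgeLaw_eq (σ : Msg) : edgeLaw lam q σ = (if σ = (one, one) then q one * q one / lam
    else q σ.1 * q σ.2) * (1 - (1 - q one) ^ (d - 1)) / ((1 - q one) * vertexNorm d (q one)) := by
  have hx : 1 - q one ≠ 0 := by linarith [hq.one_lt hd hlam]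
  have hZ := (vertexNorm_pos hq hd hlam).ne'
  have hE := (edgeNorm_pos hq hd hlam).ne'
  rw [edgeLaw, div_eq_div_iff hE (mul_ne_zero hx hZ), ← edgeNorm_eq hq hlam,
    ← frozenDen_eq hq hlam]
  ring

theorem density_empirical :
    density (empirical d lam q) one
      = q one * (1 - (1 - q one) ^ (d - 1)) / vertexNorm d (q one) ∧
    density (empirical d lam q) free
      = d * q one * (1 - q one) ^ (d - 1) / vertexNorm d (q one) ∧
    density (empirical d lam q) zero = tailProb d (q one) / vertexNorm d (q one) := by
  have hs := isSupported_empirical d lam q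
  have hx : 1 - q one ≠ 0 := by linarith [hq.one_lt hd hlam]
  have hZ := (vertexNorm_pos hq hd hlam).ne'
  have hl : lam ≠ 0 := by linarith
  have e1 : density (empirical d lam q) one
      = q one * (1 - (1 - q one) ^ (d - 1)) / vertexNorm d (q one) := by
    have hsum : q free = 1 - q one - q zero := by linarith [hq.sum_eq]
    rw [← varMarginal_one (by omega) hs, varMarginal_empirical hq hd hlam,
      varMarginal_empirical hq hd hlam, edgeLaw_eq hq hd hlam, edgeLaw_eq hq hd hlam]
    simp only [Prod.mk.injEq, reduceCtorEq, and_false, if_false]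
    rw [hsum]
    field_simp
    ring
  have e2 : density (empirical d lam q) free
      = d * q one * (1 - q one) ^ (d - 1) / vertexNorm d (q one) := by
    rw [← varMarginal_one_one (by omega) hs, varMarginal_empirical hq hd hlam,
      edgeLaw_eq hq hd hlam, if_pos rfl]
    have h := fugacity_relation hq hlam
    have h2 : q one * q one / lam * (1 - (1 - q one) ^ (d - 1))
        = q one * (1 - q one) ^ (d - 1) * (1 - q one) := by
      rw [div_mul_eq_mul_div, div_eq_iff hl]
      linear_combination -q one * h
    rw [h2]
    field_simp
  refine ⟨e1, e2, ?_⟩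
  have hb := isBalanced_empirical hq hd hlam
  have h3 := sum_density (empirical d lam q)
  rw [hb.2.2.2.1, e1, e2] at h3
  obtain ⟨-, -, -, -, -, -, h4⟩ := star_total hd (hq.one_pos hlam) (hq.one_lt hd hlam) rfl
    (rfl : _ = 1 + q one - (1 - q one) ^ (d - 1)) rfl rfl rfl
  change _ + _ + _ = (1 : ℝ) at h4
  simp only [vertexNorm] at h3 ⊢
  linarith

/-- The entropy bound is tight at the symmetric point for θ equal to the mass of q at 1; both sides
are compared in closed form after eliminating λ. -/
theorem rate_empirical_eq_rateBound :
    rate (empirical d lam q) = -rateBound d (density (empirical d lam q) one)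
      (density (empirical d lam q) free) (density (empirical d lam q) zero) (q one) := by
  obtain ⟨e1, e2, e3⟩ := density_empirical hq hd hlam
  have h0 := hq.one_pos hlam
  have h1 := hq.one_lt hd hlam
  have hy := pow_pos_lt_one hq hd hlam
  have hx : 0 < 1 - q one := by linarith
  have h1y : 0 < 1 - (1 - q one) ^ (d - 1) := by linarith
  have hZ := vertexNorm_pos hq hd hlam
  rw [rateBound_star hd h0 h1 rfl rfl e1 e2 e3, rate_empirical hq hd hlam, intensity]
  have hlog : Real.log lam = Real.log (q one) + Real.log (1 - (1 - q one) ^ (d - 1))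
      - Real.log (1 - q one) - Real.log ((1 - q one) ^ (d - 1)) := by
    have := congrArg Real.log (fugacity_relation hq hlam)
    rw [Real.log_mul (mul_pos (by linarith) hy.1).ne' hx.ne',
      Real.log_mul (by linarith) hy.1.ne', Real.log_mul h0.ne' h1y.ne'] at this
    linarith
  have hE : Real.log (edgeNorm lam (q one)) = Real.log (1 - q one)
      + Real.log (vertexNorm d (q one)) - Real.log (1 - (1 - q one) ^ (d - 1)) := by
    have h2 : edgeNorm lam (q one) * (1 - (1 - q one) ^ (d - 1))
        = (1 - q one) * vertexNorm d (q one) := by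
      rw [← frozenDen_eq hq hlam, ← edgeNorm_eq hq hlam]
      ring
    have := congrArg Real.log h2
    rw [Real.log_mul (edgeNorm_pos hq hd hlam).ne' h1y.ne', Real.log_mul hx.ne' hZ.ne'] at this
    linarith
  rw [hlog, hE, vertexNorm]
  ring

end

end FrozenModel

/-! ### Large degrees and strict maximality at fixed intensity. -/

namespace FrozenModel

open Spin

theorem one_sub_pow_mul_le {q : ℝ} (h0 : 0 ≤ q) (h1 : q ≤ 1) (n : ℕ) :
    (1 - q) ^ n * (1 + n * q) ≤ 1 := by
  have hb := one_add_mul_le_pow (show (-2 : ℝ) ≤ q by linarith) n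
  calc (1 - q) ^ n * (1 + n * q) ≤ (1 - q) ^ n * (1 + q) ^ n :=
        mul_le_mul_of_nonneg_left hb (pow_nonneg (by linarith) _)
    _ = ((1 - q) * (1 + q)) ^ n := (mul_pow _ _ _).symm
    _ ≤ 1 := pow_le_one₀ (by nlinarith) (by nlinarith)

/-- The hypothesis relates the density p of ones to the message mass q; for y = 0 it is 1/p = 1/q +
1. -/
theorem le_of_harmonic {p q y : ℝ} (hq : 0 < q) (hy : y < 1) (hp : 0 < p)
    (h : p * (1 + q - y) = q * (1 - y)) : p ≤ q := by
  have h1 : p * (1 - y) ≤ q * (1 - y) := by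
    have := mul_pos hp hq
    linarith
  exact le_of_mul_le_mul_right h1 (by linarith)

theorem harmonic_bounds {p q y n p₀ : ℝ} (hq : 0 < q) (hy0 : 0 < y) (hy : y < 1) (hn : 3 ≤ n)
    (hyn : y * (1 + n) ≤ 1) (hp : 0 < p) (hp1 : p ≤ 1 / 4) (h : p * (1 + q - y) = q * (1 - y))
    (hp₀ : 9 / 10 ≤ p₀) : q ≤ 2 * p ∧ 1 / 2 ≤ p₀ * (1 + q - y) := by
  have hy4 : y ≤ 1 / 4 := by nlinarith
  constructor
  · have : q * (1 - y) ≤ 2 * p * (1 - y) := by nlinarith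
    exact le_of_mul_le_mul_right this (by linarith)
  · nlinarith

/-- Lower bounds on the degree used in the analysis. -/
structure IsLargeDegree (d : ℕ) : Prop where
  ge : 101 ≤ d
  log_ge : 10 ≤ Real.log d
  log_le : Real.log d / d ≤ 1 / 200
  beta_le : betaMax d ≤ 1 / d
  beta_lt : 6 * (d : ℝ) < 1 / (8 * betaMax d)
  lt_beta : 8 * Real.log d * (d : ℝ) ^ (-(8 / 5) : ℝ) < betaMax d

/-- Since β_max · d · √d = 1, the bound `beta_lt` amounts to √d > 48. The bound `lt_beta` holds
because d^(−3/2) = d^(1/10) · d^(−8/5) and log d is at most d^(1/10)/16. -/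
theorem eventually_isLargeDegree : ∃ d₀ : ℕ, ∀ d : ℕ, d₀ ≤ d → IsLargeDegree d := by
  have e1 : ∀ᶠ x : ℝ in Filter.atTop, 10 ≤ Real.log x :=
    Real.tendsto_log_atTop.eventually_ge_atTop 10
  have e2 := (isLittleO_log_rpow_atTop (zero_lt_one : (0 : ℝ) < 1)).bound
    (by norm_num : (0 : ℝ) < 1 / 200)
  have e3 := (isLittleO_log_rpow_atTop (by norm_num : (0 : ℝ) < 1 / 10)).bound
    (by norm_num : (0 : ℝ) < 1 / 16)
  have e4 := (tendsto_rpow_atTop (by norm_num : (0 : ℝ) < 1 / 2)).eventually_gt_atTop 48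
  have e5 := Filter.eventually_ge_atTop (101 : ℝ)
  have h := tendsto_natCast_atTop_atTop (R := ℝ) |>.eventually
    (((((e1.and e2).and e3).and e4).and e5))
  obtain ⟨d₀, hd₀⟩ := Filter.eventually_atTop.mp h
  refine ⟨d₀, fun d hd => ?_⟩
  obtain ⟨⟨⟨⟨h1, h2⟩, h3⟩, h4⟩, h5⟩ := hd₀ d hd
  have hd0 : (0 : ℝ) < d := by linarith
  rw [Real.norm_of_nonneg (by linarith), Real.rpow_one, Real.norm_of_nonneg hd0.le] at h2
  rw [Real.norm_of_nonneg (by linarith), Real.norm_of_nonneg (by positivity)] at h3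
  have hb : 0 < betaMax d := Real.rpow_pos_of_pos hd0 _
  refine ⟨by exact_mod_cast h5, h1, ?_, ?_, ?_, ?_⟩
  · rw [div_le_iff₀ hd0]; exact h2
  · rw [one_div, ← Real.rpow_neg_one]
    exact Real.rpow_le_rpow_of_exponent_le (by linarith) (by norm_num)
  · rw [lt_div_iff₀ (by positivity)]
    have : betaMax d * (d : ℝ) * (d : ℝ) ^ (1 / 2 : ℝ) = 1 := by
      unfold betaMax
      nth_rewrite 2 [← Real.rpow_one (d : ℝ)]
      rw [← Real.rpow_add hd0, ← Real.rpow_add hd0]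
      norm_num
    have hbd : 0 < betaMax d * (d : ℝ) := by positivity
    nlinarith
  · have h6 : betaMax d = (d : ℝ) ^ (1 / 10 : ℝ) * (d : ℝ) ^ (-(8 / 5) : ℝ) := by
      rw [← Real.rpow_add hd0, betaMax]
      norm_num
    rw [h6]
    refine mul_lt_mul_of_pos_right ?_ (Real.rpow_pos_of_pos hd0 _)
    have : 0 < (d : ℝ) ^ (1 / 10 : ℝ) := Real.rpow_pos_of_pos hd0 _
    linarith

section

variable {d : ℕ} (hD : IsLargeDegree d) {α : ℝ} (hα₁ : (5 / 3) * Real.log d / d ≤ α)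
  (hα₂ : α ≤ 2 * Real.log d / d)

include hD hα₁ hα₂

theorem IsLargeDegree.alpha_bounds : 5 / d ≤ α ∧ α ≤ 1 / 100 := by
  have hd : (101 : ℝ) ≤ d := by exact_mod_cast hD.ge
  constructor
  · refine le_trans ?_ hα₁
    have := hD.log_ge
    gcongr
    linarith
  · have := hD.log_le
    rw [mul_div_assoc] at hα₂
    linarith

theorem rate_lt_rate_empirical {lam : ℝ} {q : Spin → ℝ} (hq : IsFrozenFixedPoint d lam q)
    (hlam : 1 < lam) (hH : empirical d lam q ∈ simplexAt d α) {K : Emp d}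
    (hK : K ∈ simplexAt d α) (hne : K ≠ empirical d lam q) :
    rate K < rate (empirical d lam q) := by
  have hd : (101 : ℝ) ≤ d := by exact_mod_cast hD.ge
  have hd101 := hD.ge
  have hd3 : 3 ≤ d := by omega
  obtain ⟨a1, a2⟩ := hD.alpha_bounds hα₁ hα₂
  obtain ⟨⟨hHb, hHβ⟩, hHα⟩ := hH
  obtain ⟨⟨hKb, hKβ⟩, hKα⟩ := hK
  obtain ⟨e1, e2, e3⟩ := density_empirical hq hd3 hlam
  have hrate := rate_empirical_eq_rateBound hq hd3 hlam
  have hq0 := hq.one_pos hlam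
  have hq1 := hq.one_lt hd3 hlam
  obtain ⟨hZ0, hZ, hy0, hy1, -, -, hs⟩ := star_total hd3 hq0 hq1 rfl rfl e1 e2 e3
  have hKs := sum_density K
  rw [hKb.2.2.2.1] at hKs
  unfold intensity at hHα hKα
  have hKβ0 := density_nonneg hKb free
  have hHβ0 := density_nonneg hHb free
  have hbeta := hD.beta_le
  have hbetalt := hD.beta_lt
  have hi : 5 / (d : ℝ) = 5 * (1 / d) := by ring
  have hip : 0 < 1 / (d : ℝ) := by positivity
  rw [hi] at a1
  have hdi : (d : ℝ) * (1 / d) = 1 := by field_simp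
  have hyq := one_sub_pow_mul_le hq0.le hq1.le (d - 1)
  rw [Nat.cast_pred (by omega : 0 < d)] at hyq
  have hlt := @rateBound_ge d (q one) _ _ _ _ _ hd3 hq0 hq1 rfl rfl e1 e2 e3
    (density K free - density (empirical d lam q) free) (betaMax d)
  have hZ1 : vertexNorm d (q one) ≠ 0 := hZ0
  rw [eq_div_iff hZ1] at e1 e3
  generalize hy : (1 - q one) ^ (d - 1) = y at *
  generalize hρ1 : density (empirical d lam q) one = p₁ at *
  generalize hρ2 : density (empirical d lam q) free = β at *
  generalize hρ3 : density (empirical d lam q) zero = p₀ at *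
  generalize hβ' : density K free = β' at *
  generalize hir : 1 / (d : ℝ) = r at *
  -- Equal intensity and total mass one leave the free density as the only free parameter.
  have k1 : density K one = p₁ - (β' - β) / 2 := by linarith
  have k0 : density K zero = p₀ - (β' - β) / 2 := by linarith
  have hZe : vertexNorm d (q one) = 1 + q one - y := by rw [vertexNorm, hy]
  have hp1 : 4 * r ≤ p₁ := by linarith
  have hp1K : 4 * r ≤ p₁ - (β' - β) / 2 := by linarith
  have hp1' : 0 < p₁ := by linarith
  rw [hZe] at e1 e3
  have hqp : p₁ ≤ q one := le_of_harmonic hq0 hy1 hp1' e1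
  have hqd : 3 ≤ (d - 1) * q one := by
    have : (d : ℝ) * (4 * r) ≤ d * q one := mul_le_mul_of_nonneg_left (by linarith) (by linarith)
    linarith
  obtain ⟨hq2p, hP⟩ := harmonic_bounds hq0 hy0 hy1 hqd hyq hp1' (by linarith) e1
    (by linarith : 9 / 10 ≤ p₀)
  rw [e3] at hP
  obtain ⟨θ, hθ⟩ : ∃ θ, θ = q one * (p₁ - (β' - β) / 2) / p₁ := ⟨_, rfl⟩
  have hθ1 : p₁ - (β' - β) / 2 ≤ θ := by
    rw [hθ, le_div_iff₀ hp1', mul_comm]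
    exact mul_le_mul_of_nonneg_right hqp (by linarith)
  have hθ2 : θ ≤ 2 * (p₁ - (β' - β) / 2) := by
    rw [hθ, div_le_iff₀ hp1']
    have := mul_le_mul_of_nonneg_right hq2p (by linarith : 0 ≤ p₁ - (β' - β) / 2)
    linarith
  have hθd : 1 ≤ (d - 1) * θ := by
    have : (d : ℝ) * (4 * r) ≤ d * θ := mul_le_mul_of_nonneg_left (by linarith) (by linarith)
    linarith
  have hm : 1 / 2 ≤ p₀ - p₁ := by linarith
  have hlt := hlt (by linarith) (by linarith) hθd (by linarith) hθ hq2p hm hP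
    (by linarith) hHβ (by linarith)
  rw [add_sub_cancel] at hlt
  have hub := (rate_le hKb hd3 (θ := θ) (by linarith) (by linarith) (by linarith)
    (by linarith)).1
  rw [k1, k0, hβ'] at hub
  -- With equal densities strictness must come from the relative entropies; otherwise it comes from
  -- the quadratic gain.
  by_cases hδ : β' - β = 0
  · have hββ : β' = β := by linarith
    rw [hδ, zero_div, sub_zero] at k1 k0
    have hubK := rate_le hKb hd3 (θ := q one) hq0 hq1 (by linarith) (by linarith)
    have hubH := rate_le hHb hd3 (θ := q one) hq0 hq1 (by linarith) (by linarith)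
    rw [hρ1, hρ2, hρ3] at hubH
    rw [k1, k0, hβ', hββ] at hubK
    by_contra! hge
    obtain ⟨c1, c2, c3⟩ := hubK.2 (by linarith)
    obtain ⟨b1, b2, b3⟩ := hubH.2 (by linarith)
    refine hne (eq_of_eq_comparison hd3 hKb hHb (by linarith) (by linarith) c1 b1 c2 b2 ?_)
    have hT : (1 - r) * β + (p₀ - p₁) ≠ 0 := by
      have : r ≤ 1 := by linarith
      have : 0 ≤ (1 - r) * β := mul_nonneg (by linarith) hHβ0
      linarith
    rw [hir] at c3 b3
    exact mul_right_cancel₀ hT (c3.trans b3.symm)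
  · have hpos : 0 < (β' - β) ^ 2 := by positivity
    have : 0 < (β' - β) ^ 2 * (1 / (8 * betaMax d) - 6 * d) := mul_pos hpos (by linarith)
    linarith

end

end FrozenModel

/-! ### The correspondence between intensity and fugacity. -/

namespace FrozenModel

open Spin

section

variable {d : ℕ} (hD : IsLargeDegree d)

include hD

theorem IsLargeDegree.pow_le {r : ℝ} (h : (8 / 5) * Real.log d / (d - 1) ≤ r) (h1 : r ≤ 1) :
    (1 - r) ^ (d - 1) ≤ (d : ℝ) ^ (-(8 / 5) : ℝ) := by
  have hd : (101 : ℝ) ≤ d := by exact_mod_cast hD.ge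
  have hd1 := hD.ge
  calc (1 - r) ^ (d - 1) ≤ (Real.exp (-r)) ^ (d - 1) := by
        refine pow_le_pow_left₀ (by linarith) ?_ _
        linarith [Real.add_one_le_exp (-r)]
    _ = Real.exp (-((d - 1) * r)) := by
        rw [← Real.exp_nat_mul, Nat.cast_pred (by omega)]
        ring_nf
    _ ≤ Real.exp (Real.log d * -(8 / 5)) := by
        rw [div_le_iff₀ (by linarith)] at h
        apply Real.exp_le_exp.mpr
        linarith
    _ = (d : ℝ) ^ (-(8 / 5) : ℝ) := (Real.rpow_def_of_pos (by linarith) _).symm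

/-- Intermediate values for r from (8/5) log d/(d − 1) to 4 log d/d. There (1 − r)^(d−1) ≤ d^(−8/5),
so the free density is at most 8 log d · d^(−8/5) < β_max, and the intensity is r up to lower-order
corrections. -/
theorem exists_intensity {α : ℝ} (hα₁ : (5 / 3) * Real.log d / d ≤ α)
    (hα₂ : α ≤ 2 * Real.log d / d) :
    ∃ r : ℝ, 0 < r ∧ r < 1 ∧ (1 - r) ^ (d - 1) < r ∧
      (r * (1 - (1 - r) ^ (d - 1)) + 1 / 2 * (d * r * (1 - r) ^ (d - 1))) / vertexNorm d r = α ∧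
      d * r * (1 - r) ^ (d - 1) / vertexNorm d r < betaMax d := by
  have hd : (101 : ℝ) ≤ d := by exact_mod_cast hD.ge
  have hd0 : (0 : ℝ) < d := by linarith
  have hL := hD.log_ge
  have hLd := hD.log_le
  have hβ1 := hD.beta_le
  have hβ2 := hD.lt_beta
  obtain ⟨L, hLe⟩ : ∃ L, L = Real.log d := ⟨_, rfl⟩
  obtain ⟨u, hu⟩ : ∃ u : ℝ, u = (d : ℝ) ^ (-(8 / 5) : ℝ) := ⟨_, rfl⟩
  obtain ⟨lo, hlo⟩ : ∃ lo : ℝ, lo = (8 / 5) * L / (d - 1) := ⟨_, rfl⟩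
  obtain ⟨hi, hhi⟩ : ∃ hi : ℝ, hi = 4 * L / d := ⟨_, rfl⟩
  rw [← hLe] at hL hLd hα₁ hα₂
  rw [← hLe, ← hu] at hβ2
  have hu0 : 0 < u := by rw [hu]; exact Real.rpow_pos_of_pos hd0 _
  have hu1 : u < 1 / d := by
    have : 8 * L * u ≥ 80 * u := by nlinarith
    linarith
  have hd101 : 1 / (d : ℝ) ≤ 1 / 101 := one_div_le_one_div_of_le (by norm_num) hd
  have hlo0 : 1 / (d : ℝ) ≤ lo := by
    rw [hlo, div_le_div_iff₀ hd0 (by linarith)]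
    nlinarith
  have hlohi : lo ≤ hi := by
    rw [hlo, hhi, div_le_div_iff₀ (by linarith) hd0]
    nlinarith
  -- The gap between 8/5 and 5/3 pays for d/(d − 1) ≤ 101/100 and for half the free density, at most
  -- 1/(2d): what is left, about 0.0507 · log d, exceeds 1/2 since log d ≥ 10.
  have hlo2 : lo + 1 / 2 * (1 / d) ≤ α := by
    refine le_trans ?_ hα₁
    have : lo ≤ (101 / 100) * (8 / 5) * L / d := by
      rw [hlo, div_le_div_iff₀ (by linarith) hd0]
      nlinarith
    have h2 : (5 / 3) * L / d = (101 / 100) * (8 / 5) * L / d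
        + (5 / 3 - (101 / 100) * (8 / 5)) * L * (1 / d) := by ring
    have h3 : 1 / 2 * (1 / (d : ℝ)) ≤ (5 / 3 - (101 / 100) * (8 / 5)) * L * (1 / d) :=
      mul_le_mul_of_nonneg_right (by linarith) (by positivity)
    linarith
  have hhi1 : hi ≤ 1 / 50 := by
    rw [hhi, mul_div_assoc]
    linarith
  have hpow : ∀ r ∈ Set.Icc lo hi, 0 < (1 - r) ^ (d - 1) ∧ (1 - r) ^ (d - 1) ≤ u := by
    intro r hr
    have h1 := hr.1
    have h2 := hr.2
    refine ⟨pow_pos (by linarith) _, ?_⟩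
    rw [hu]
    refine hD.pow_le ?_ (by linarith)
    rw [← hLe, ← hlo]
    exact h1
  have hlo1 : 0 < lo := lt_of_lt_of_le (by positivity) hlo0
  have hden : ∀ r ∈ Set.Icc lo hi, 9 / 10 ≤ vertexNorm d r := by
    intro r hr
    have := hpow r hr
    have := hr.1
    unfold vertexNorm
    linarith
  have hβ : ∀ r ∈ Set.Icc lo hi, d * r * (1 - r) ^ (d - 1) / vertexNorm d r < betaMax d := by
    intro r hr
    have h1 := hpow r hr
    have h2 := hden r hr
    refine lt_of_le_of_lt ?_ hβ2
    rw [div_le_iff₀ (by linarith)]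
    have h3 : d * r ≤ 4 * L := by
      have := hr.2
      rw [hhi, le_div_iff₀ hd0] at this
      linarith
    have h4 : d * r * (1 - r) ^ (d - 1) ≤ 4 * L * u :=
      mul_le_mul h3 h1.2 h1.1.le (by linarith)
    have h5 : 0 ≤ L * u := by positivity
    nlinarith
  have hcont : ContinuousOn (fun r : ℝ => (r * (1 - (1 - r) ^ (d - 1))
      + 1 / 2 * (d * r * (1 - r) ^ (d - 1))) / vertexNorm d r) (Set.Icc lo hi) := by
    refine ContinuousOn.div (by fun_prop) (by unfold vertexNorm; fun_prop) fun r hr => ?_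
    linarith [hden r hr]
  obtain ⟨r, hr, hrα⟩ := intermediate_value_Icc hlohi hcont (show α ∈ Set.Icc _ _ from by
    constructor
    · have hmem : lo ∈ Set.Icc lo hi := ⟨le_rfl, hlohi⟩
      have h1 := hpow lo hmem
      have h2 := hden lo hmem
      have h3 := hβ lo hmem
      refine le_trans ?_ hlo2
      simp only [add_div, mul_div_assoc (1 / 2 : ℝ)]
      have h4 : lo * (1 - (1 - lo) ^ (d - 1)) / vertexNorm d lo ≤ lo := by
        rw [div_le_iff₀ (by linarith)]
        refine mul_le_mul_of_nonneg_left ?_ hlo1.le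
        unfold vertexNorm
        linarith
      linarith
    · have hmem : hi ∈ Set.Icc lo hi := ⟨hlohi, le_rfl⟩
      have h1 := hpow hi hmem
      have h2 := hden hi hmem
      have hhi0 : 0 < hi := by linarith
      refine le_trans (b := hi / 2) ?_ ?_
      · refine hα₂.trans (le_of_eq ?_)
        rw [hhi]
        ring
      · rw [le_div_iff₀ (by linarith)]
        have h3 : 0 ≤ 1 / 2 * (d * hi * (1 - hi) ^ (d - 1)) := by
          have := h1.1
          positivity
        have h4 : hi / 2 * vertexNorm d hi ≤ hi * (1 - (1 - hi) ^ (d - 1)) := by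
          have : hi / 2 * vertexNorm d hi = hi * (vertexNorm d hi / 2) := by ring
          rw [this]
          refine mul_le_mul_of_nonneg_left ?_ hhi0.le
          unfold vertexNorm
          linarith
        linarith)
  have h1 := hpow r hr
  refine ⟨r, by linarith [hr.1], by linarith [hr.2], by linarith [hr.1], hrα, hβ r hr⟩

end

/-- Solve the first frozen recursion for λ; with y = (1 − r)^(d−1) the solution r(1 − y)/((1 − r)y)
exceeds 1 exactly when y < r. -/
theorem exists_fugacity {d : ℕ} (hd : 3 ≤ d) {r : ℝ} (h0 : 0 < r) (h1 : r < 1)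
    (hy : (1 - r) ^ (d - 1) < r) :
    ∃ lam, 1 < lam ∧ IsFrozenFixedPoint d lam (frozenLaw d lam r) := by
  have hx : 0 < 1 - r := by linarith
  have hy0 : 0 < (1 - r) ^ (d - 1) := pow_pos hx _
  have hlam : 1 < r * (1 - (1 - r) ^ (d - 1)) / ((1 - r) * (1 - r) ^ (d - 1)) := by
    rw [one_lt_div (by positivity)]
    linarith
  refine ⟨_, hlam, isFrozenFixedPoint_frozenLaw hd hlam h0 h1 ?_⟩
  rw [eq_div_iff (frozenDen_pos hlam h1.le).ne', frozenDen]
  field_simp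
  ring

/-- Edge marginals with incoming 0 carry no factor of λ and are proportional to q. Normalizing them
recovers the mass at 1, and `fugacity_relation` then recovers λ. -/
theorem eq_of_empirical_eq {d : ℕ} (hd : 3 ≤ d) {lam mu : ℝ} {p q : Spin → ℝ} (hlam : 1 < lam)
    (hmu : 1 < mu) (hp : IsFrozenFixedPoint d mu p) (hq : IsFrozenFixedPoint d lam q)
    (h : empirical d mu p = empirical d lam q) : mu = lam := by
  have hm : ∀ σ, edgeLaw mu p σ = edgeLaw lam q σ := fun σ => by
    rw [← varMarginal_empirical hp hd hmu, ← varMarginal_empirical hq hd hlam, h]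
  have m0 := hm (zero, zero)
  have m1 := hm (one, zero)
  have mf := hm (free, zero)
  simp only [edgeLaw, Prod.mk.injEq, reduceCtorEq, and_false, if_false] at m0 m1 mf
  have a0 := hp.zero_pos hd hmu
  have b0 := hq.zero_pos hd hlam
  have sp := hp.sum_eq
  have sq := hq.sum_eq
  have c0 : 0 < p zero / edgeNorm mu (p one) := div_pos a0 (edgeNorm_pos hp hd hmu)
  have c1 : p zero / edgeNorm mu (p one) = q zero / edgeNorm lam (q one) := by
    have e1 : (p zero * p zero + p one * p zero + p free * p zero) / edgeNorm mu (p one)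
        = (q zero * q zero + q one * q zero + q free * q zero) / edgeNorm lam (q one) := by
      rw [add_div, add_div, m0, m1, mf, add_div, add_div]
    rwa [← add_mul, ← add_mul, ← add_mul, ← add_mul, sp, sq, one_mul, one_mul] at e1
  have h1 : p one = q one := by
    rw [mul_div_assoc, mul_div_assoc, c1] at m1
    rw [c1] at c0
    exact mul_right_cancel₀ c0.ne' m1
  have r1 := fugacity_relation hp hmu
  have r2 := fugacity_relation hq hlam
  rw [h1, ← r2] at r1
  have hx : 0 < 1 - q one := by linarith [hq.one_lt hd hlam]
  have hy := (pow_pos_lt_one hq hd hlam).1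
  exact mul_right_cancel₀ hy.ne' (mul_right_cancel₀ hx.ne' r1)

end FrozenModel

/-! ### Assembly of the theorem. -/

open FrozenModel in
theorem mainTheorem6 :
    ∃ d₀ : ℕ, ∀ d : ℕ, d₀ ≤ d →
      ∃ (q : ℝ → FrozenModel.Spin → ℝ) (h : ℝ → FrozenModel.Messages)
        (H : ℝ → FrozenModel.Emp d),
        (∀ lam : ℝ, 1 < lam →
          (∀ p, FrozenModel.IsFrozenFixedPoint d lam p ↔ p = q lam) ∧
          (∀ k, (FrozenModel.IsBetheSolution d lam k ∧ FrozenModel.BetheSymmetric lam k)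
            ↔ k = h lam) ∧
          (∀ η' η : FrozenModel.Spin, (h lam).2 (η', η) = q lam η / 3) ∧
          (∀ K : FrozenModel.Emp d,
            (FrozenModel.IsStationary lam K ∧ FrozenModel.Corresponds lam (h lam) K)
              ↔ K = H lam)) ∧
        (∀ α : ℝ, (5 / 3) * Real.log d / d ≤ α → α ≤ 2 * Real.log d / d →
          ∃ lam : ℝ, 1 < lam ∧ H lam ∈ FrozenModel.simplexAt d α ∧
            (∀ mu : ℝ, 1 < mu → H mu ∈ FrozenModel.simplexAt d α → mu = lam) ∧
            FrozenModel.density (H lam) FrozenModel.Spin.free < FrozenModel.betaMax d ∧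
            (∀ K ∈ FrozenModel.simplexAt d α, K ≠ H lam →
              FrozenModel.rate K < FrozenModel.rate (H lam))) := by
  obtain ⟨d₀, hd₀⟩ := eventually_isLargeDegree
  refine ⟨d₀, fun d hdd => ?_⟩
  have hD := hd₀ d hdd
  have hd : 3 ≤ d := le_trans (by norm_num) hD.ge
  -- A total function of λ is required; for λ ≤ 1 its value is an irrelevant 0.
  have hex : ∀ lam : ℝ, ∃ q, 1 < lam → IsFrozenFixedPoint d lam q := by
    intro lam
    by_cases h : 1 < lam
    · obtain ⟨q, hq⟩ := exists_isFrozenFixedPoint hd h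
      exact ⟨q, fun _ => hq⟩
    · exact ⟨0, fun h' => absurd h' h⟩
  choose q hq using hex
  refine ⟨q, fun lam => messages lam (q lam), fun lam => empirical d lam (q lam),
    fun lam hlam => ⟨fun p => ⟨fun hp => (hq lam hlam).eq hlam hp, ?_⟩,
      fun k => ⟨fun hk => eq_messages hd hlam (hq lam hlam) hk.1 hk.2, ?_⟩,
      fun η' η => rfl,
      fun K => ⟨fun hK => eq_empirical (hq lam hlam) hd hlam hK.1.1 hK.2, ?_⟩⟩, ?_⟩
  · rintro rfl
    exact hq lam hlam
  · rintro rfl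
    exact isBethe_messages hd hlam (hq lam hlam)
  · rintro rfl
    exact ⟨isStationary_empirical (hq lam hlam) hd hlam,
      corresponds_empirical (hq lam hlam) hd hlam⟩
  · intro α hα₁ hα₂
    obtain ⟨r, h0, h1, hy, hrα, hrβ⟩ := exists_intensity hD hα₁ hα₂
    obtain ⟨lam, hlam, hfix⟩ := exists_fugacity hd h0 h1 hy
    have hqr : q lam Spin.one = r := by
      rw [← (hq lam hlam).eq hlam hfix]
      rfl
    obtain ⟨e1, e2, -⟩ := density_empirical (hq lam hlam) hd hlam
    rw [hqr] at e1 e2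
    have hβ : density (empirical d lam (q lam)) Spin.free < betaMax d := by
      rw [e2]
      exact hrβ
    have hmem : empirical d lam (q lam) ∈ simplexAt d α := by
      refine ⟨⟨isBalanced_empirical (hq lam hlam) hd hlam, hβ.le⟩, ?_⟩
      rw [intensity, e1, e2, ← hrα]
      ring
    have hmax := fun K hK hne => rate_lt_rate_empirical hD hα₁ hα₂ (hq lam hlam) hlam hmem
      (K := K) hK hne
    refine ⟨lam, hlam, hmem, fun mu hmu hmum => ?_, hβ, hmax⟩
    -- Two different fugacities would give two different pairs in the same slice, each with strictly
    -- larger rate than the other.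
    by_contra hne
    have hne' : empirical d mu (q mu) ≠ empirical d lam (q lam) := fun h =>
      hne (eq_of_empirical_eq hd hlam hmu (hq mu hmu) (hq lam hlam) h)
    exact lt_asymm (hmax _ hmum hne')
      (rate_lt_rate_empirical hD hα₁ hα₂ (hq mu hmu) hmu hmum hmem hne'.symm)
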